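/- Let $d\ge 2$, let $\mathcal D\subset\mathbb R^d$ be a bounded open set and $\mathcal K=\{0,\dots,\kappa-1\}$. **Setting.** A $\mathcal K$-partition of $\mathcal D$ is a vector $\mathbf\Omega=(\Omega_0,\dots,\Omega_{\kappa-1})$ of pairwise disjoint open subsets of $\mathcal D$ with $\bigcup_k\overline{\Omega_k}=\overline{\mathcal D}$; $\mathbb P_\kappa(\mathcal D)$ is the set of all such vectors. A boundary point of $\mathcal D$ is *regular* if near it, in suitable orthonormal coordinates, $\mathcal D$ is the strict epigraph of a $C^1$ function, and *singular* otherwise. Let $C^1_{\partial\mathcal D}(\overline{\mathcal D},\mathbb R^d)$ be the set of restrictions to $\overline{\mathcal D}$ of $C^1$ fields $\theta:\mathbb R^d\to\mathbb R^d$ such that $\theta\cdot n=0$ at the regular points of $\partial\mathcal D$ ($n$ the outward unit normal) and $\theta=0$ at the singular points. For such $\theta$ let $\Phi_t:\overline{\mathcal D}\to\overline{\mathcal D}$ be the flow of $\dot x=\theta(x)$. The Eulerian shape derivative of $\mathcal J:\mathbb P_\kappa(\mathcal D)\to\mathbb R$ at $\mathbf\Omega$ in direction $\theta$ is $$d\mathcal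 J(\mathbf\Omega)(\theta)=\lim_{t\searrow0}\frac{\mathcal J(\Phi_t(\Omega_0),\dots,\Phi_t(\Omega_{\kappa-1}))-\mathcal J(\mathbf\Omega)}{t}.$$ **Statement.** Let $\mathbf\Omega\in\mathbb P_\kappa(\mathcal D)$, $\mathcal J:\mathbb P_\kappa(\mathcal D)\to\mathbb R$, $S_0\in L^1(\mathcal D,\mathbb R^d)$ and $S_1\in L^1(\mathcal D,\mathbb R^{d\times d})$ be such that for every $\theta\in C^1_{\partial\mathcal D}(\overline{\mathcal D},\mathbb R^d)$ the Eulerian shape derivative exists and $$d\mathcal J(\mathbf\Omega)(\theta)=\int_{\mathcal D}S_1:D\theta+S_0\cdot\theta .$$ Assume $S_1\in W^{1,1}(\Omega_k,\mathbb R^{d\times d})$ for all $k\in\mathcal K$. Here $(D\theta)_{ij}=\partial_j\theta_i$, derivatives of $S_1$ are weak derivatives, and the divergence of a matrix field is taken row by row. Then: 1. $\operatorname{div}(S_1)=S_0$ almost everywhere in $\Omega_k$, for all $k\in\mathcal K$. 2. If the interfaces are not thick, that is, if $\mathcal D\setminus\bigcup_k\Omega_k$ has Lebesgue measure zero, then for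 all $\theta\in C^1_{\partial\mathcal D}(\overline{\mathcal D},\mathbb R^d)$ we have $S_1^{\mathsf T}\theta\in W^{1,1}(\Omega_k,\mathbb R^d)$ for all $k$ and $$d\mathcal J(\mathbf\Omega)(\theta)=\sum_{k\in\mathcal K}\int_{\Omega_k}\operatorname{div}(S_1^{\mathsf T}\theta).$$ 3. If every $\Omega_k$ is Lipschitz (near each boundary point it is, in suitable orthonormal coordinates, the strict epigraph of a Lipschitz function), then ${S_1}_{|\Omega_k}$ has a trace $S_{1,k}\in L^1(\partial\Omega_k,\mathbb R^{d\times d})$ for all $k$, and for all $\theta\in C^1_{\partial\mathcal D}(\overline{\mathcal D},\mathbb R^d)$ $$d\mathcal J(\mathbf\Omega)(\theta)=\sum_{k\in\mathcal K}\int_{\partial\Omega_k}(S_{1,k}n_k)\cdot\theta ,$$ where $n_k$ is the outward unit normal to $\Omega_k$ (defined almost everywhere on $\partial\Omega_k$) and the integrals are with respect to surface measure. The trace is the $L^1(\partial\Omega_k)$-limit of the boundary values of functions that are smooth up to the boundary and converge in $W^{1,1}(\Omega_k)$; the integrands on $\partial\Omega_k$ are integrable. -/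

import Mathlib

open MeasureTheory Set Filter Topology
open scoped ContDiff NNReal ENNReal

noncomputable section

namespace MultiphaseShape

variable {d κ : ℕ}

/-! ## Partitions, admissible vector fields and Eulerian shape derivatives -/

/-- A `κ`-partition of `D ⊆ ℝᵈ`: a vector `(Ω₀, …, Ω_{κ-1})` of pairwise disjoint open subsets
of `D` whose closures cover the closure of `D`. -/
@[ext]
structure KPartition (D : Set (EuclideanSpace ℝ (Fin d))) (κ : ℕ) where
  phase : Fin κ → Set (EuclideanSpace ℝ (Fin d))
  isOpen_phase : ∀ k, IsOpen (phase k)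
  phase_subset : ∀ k, phase k ⊆ D
  disjoint_phase : ∀ k l, k ≠ l → Disjoint (phase k) (phase l)
  iUnion_closure : (⋃ k, closure (phase k)) = closure D

/-- In the ball `B(x, r)` the set `Ω` is the strict epigraph, in the direction of the unit vector
`e`, of the function `γ` evaluated at the orthogonal projection on the hyperplane `e^⊥`. -/
def IsLocalEpigraph (Ω : Set (EuclideanSpace ℝ (Fin d))) (x e : EuclideanSpace ℝ (Fin d)) (r : ℝ)
    (γ : EuclideanSpace ℝ (Fin d) → ℝ) : Prop :=
  ‖e‖ = 1 ∧ 0 < r ∧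
    ∀ y ∈ Metric.ball x r, (y ∈ Ω ↔ γ (y - (inner ℝ e y) • e) < inner ℝ e y)

/-- `Ω` is a Lipschitz set: near each of its boundary points it is, in suitable orthonormal
coordinates, the strict epigraph of a Lipschitz function. (Used for bounded open sets.) -/
def IsLipschitzSet (Ω : Set (EuclideanSpace ℝ (Fin d))) : Prop :=
  ∀ x ∈ frontier Ω, ∃ (e : EuclideanSpace ℝ (Fin d)) (r : ℝ) (γ : EuclideanSpace ℝ (Fin d) → ℝ),
    IsLocalEpigraph Ω x e r γ ∧ ∃ K : ℝ≥0, LipschitzWith K γ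

/-- `x ∈ ∂Ω` is a regular point of the boundary: near `x`, `Ω` is the strict epigraph of a `C¹`
function. The other boundary points are the singular points. -/
def IsRegularBoundaryPoint (Ω : Set (EuclideanSpace ℝ (Fin d)))
    (x : EuclideanSpace ℝ (Fin d)) : Prop :=
  x ∈ frontier Ω ∧
    ∃ (e : EuclideanSpace ℝ (Fin d)) (r : ℝ) (γ : EuclideanSpace ℝ (Fin d) → ℝ),
      IsLocalEpigraph Ω x e r γ ∧ ContDiff ℝ 1 γ

/-- `ν` is the outward unit normal to `Ω` at the boundary point `x`: every open cone around `-ν`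
with vertex `x`, of half-angle less than a right angle, lies in `Ω` near `x`, and every such cone
around `ν` lies outside `Ω` near `x`. Such a `ν` is unique. It exists at every point at which a
local graph of the boundary is differentiable, so almost everywhere on a Lipschitz boundary. -/
def IsOutwardUnitNormal (Ω : Set (EuclideanSpace ℝ (Fin d)))
    (x ν : EuclideanSpace ℝ (Fin d)) : Prop :=
  ‖ν‖ = 1 ∧ ∀ ε > 0, ∃ δ > 0, ∀ y ∈ Metric.ball x δ,
    (inner ℝ (y - x) ν < -(ε * ‖y - x‖) → y ∈ Ω) ∧
    (ε * ‖y - x‖ < inner ℝ (y - x) ν → y ∉ Ω)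

open Classical in
/-- The outward unit normal to `Ω` at `x` (zero where there is none). -/
def outwardNormal (Ω : Set (EuclideanSpace ℝ (Fin d))) (x : EuclideanSpace ℝ (Fin d)) :
    EuclideanSpace ℝ (Fin d) :=
  if h : ∃ ν, IsOutwardUnitNormal Ω x ν then h.choose else 0

/-- The class `C¹_{∂D}(closure D, ℝᵈ)`: `C¹` fields up to the boundary (restrictions to `closure D`
of `C¹` fields on `ℝᵈ`), tangential at the regular points of `∂D` and zero at the singular
points. Only the values on `closure D` are ever used. -/
def IsAdmissibleField (D : Set (EuclideanSpace ℝ (Fin d)))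
    (θ : EuclideanSpace ℝ (Fin d) → EuclideanSpace ℝ (Fin d)) : Prop :=
  ContDiff ℝ 1 θ ∧
    (∀ x, IsRegularBoundaryPoint D x → inner ℝ (θ x) (outwardNormal D x) = 0) ∧
    (∀ x ∈ frontier D, ¬ IsRegularBoundaryPoint D x → θ x = 0)

/-- `Φ t : closure D → closure D`, `0 ≤ t ≤ t₀`, is the flow of the field `θ`. -/
def IsFlowOn (D : Set (EuclideanSpace ℝ (Fin d)))
    (θ : EuclideanSpace ℝ (Fin d) → EuclideanSpace ℝ (Fin d)) (t₀ : ℝ)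
    (Φ : ℝ → EuclideanSpace ℝ (Fin d) → EuclideanSpace ℝ (Fin d)) : Prop :=
  ∀ x ∈ closure D, Φ 0 x = x ∧ ∀ t ∈ Icc 0 t₀,
    Φ t x ∈ closure D ∧ HasDerivWithinAt (fun s => Φ s x) (θ (Φ t x)) (Icc 0 t₀) t

/-- The functional `J` has the Eulerian shape derivative `L` at the partition `Ω` in the direction
`θ`: with `Ω_t = Φ_t(Ω)` the image of `Ω` under the flow of `θ`,
`(J(Ω_t) - J(Ω)) / t → L` as `t ↘ 0`. -/
def HasEulerianDeriv {D : Set (EuclideanSpace ℝ (Fin d))} (J : KPartition D κ → ℝ)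
    (Ω : KPartition D κ) (θ : EuclideanSpace ℝ (Fin d) → EuclideanSpace ℝ (Fin d)) (L : ℝ) :
    Prop :=
  ∃ t₀ > 0, ∃ Φ : ℝ → EuclideanSpace ℝ (Fin d) → EuclideanSpace ℝ (Fin d),
    IsFlowOn D θ t₀ Φ ∧
    ∃ Ωt : ℝ → KPartition D κ,
      (∀ t ∈ Icc 0 t₀, ∀ k, (Ωt t).phase k = Φ t '' Ω.phase k) ∧
      Tendsto (fun t => (J (Ωt t) - J Ω) / t) (𝓝[>] 0) (𝓝 L)

/-- The shape derivative of `J` at `Ω` has the first-order tensor representation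
`dJ(Ω)(θ) = ∫_D S₁ : Dθ + S₀ · θ` for all admissible `θ`, with `S₀`, `S₁` in `L¹(D)`. -/
def HasTensorRepresentation {D : Set (EuclideanSpace ℝ (Fin d))} (J : KPartition D κ → ℝ)
    (Ω : KPartition D κ) (S₀ : EuclideanSpace ℝ (Fin d) → EuclideanSpace ℝ (Fin d))
    (S₁ : EuclideanSpace ℝ (Fin d) → Matrix (Fin d) (Fin d) ℝ) : Prop :=
  IntegrableOn S₀ D ∧ (∀ i j, IntegrableOn (fun x => S₁ x i j) D) ∧
    ∀ θ, IsAdmissibleField D θ →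
      HasEulerianDeriv J Ω θ
        (∫ x in D, ((∑ i, ∑ j, S₁ x i j * (fderiv ℝ θ x (EuclideanSpace.single j 1)) i)
          + inner ℝ (S₀ x) (θ x)))

/-! ## Weak derivatives, `W^{1,1}`, traces -/

/-- `g` is the weak partial derivative `∂ᵢ u` in the open set `Ω`. -/
def HasWeakPartial (Ω : Set (EuclideanSpace ℝ (Fin d))) (i : Fin d)
    (u g : EuclideanSpace ℝ (Fin d) → ℝ) : Prop :=
  ∀ φ : EuclideanSpace ℝ (Fin d) → ℝ, ContDiff ℝ ∞ φ → HasCompactSupport φ → tsupport φ ⊆ Ω →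
    ∫ x in Ω, u x * fderiv ℝ φ x (EuclideanSpace.single i 1) = - ∫ x in Ω, g x * φ x

/-- `u ∈ W^{1,1}(Ω)`. -/
def MemW11 (Ω : Set (EuclideanSpace ℝ (Fin d))) (u : EuclideanSpace ℝ (Fin d) → ℝ) : Prop :=
  IntegrableOn u Ω ∧ ∀ i, ∃ g, IntegrableOn g Ω ∧ HasWeakPartial Ω i u g

open Classical in
/-- The weak partial derivative `∂ᵢ u ∈ L¹(Ω)` (well defined almost everywhere in `Ω` if it
exists, and zero if it does not). -/
def weakPartial (Ω : Set (EuclideanSpace ℝ (Fin d))) (i : Fin d)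
    (u : EuclideanSpace ℝ (Fin d) → ℝ) : EuclideanSpace ℝ (Fin d) → ℝ :=
  if h : ∃ g, IntegrableOn g Ω ∧ HasWeakPartial Ω i u g then h.choose else 0

/-- The divergence `∑ⱼ ∂ⱼ Fⱼ` in `Ω` of a vector field with components `Fⱼ`. The divergence of a
matrix field is taken row by row. -/
def weakDiv (Ω : Set (EuclideanSpace ℝ (Fin d))) (F : Fin d → EuclideanSpace ℝ (Fin d) → ℝ)
    (x : EuclideanSpace ℝ (Fin d)) : ℝ :=
  ∑ j, weakPartial Ω j (F j) x

/-- Surface measure on `∂Ω`: the `(d-1)`-dimensional Hausdorff measure, in the Euclidean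
normalization. -/
def surfaceMeasure (Ω : Set (EuclideanSpace ℝ (Fin d))) : Measure (EuclideanSpace ℝ (Fin d)) :=
  (μHE[d - 1]).restrict (frontier Ω)

/-- `g ∈ L¹(∂Ω)` is the trace on `∂Ω` of `u ∈ W^{1,1}(Ω)`: it is the limit in `L¹(∂Ω)` of the
boundary values of smooth functions (up to the boundary) converging to `u` in `W^{1,1}(Ω)`. -/
def IsTrace (Ω : Set (EuclideanSpace ℝ (Fin d))) (u g : EuclideanSpace ℝ (Fin d) → ℝ) : Prop :=
  MemW11 Ω u ∧ Integrable g (surfaceMeasure Ω) ∧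
    ∃ v : ℕ → EuclideanSpace ℝ (Fin d) → ℝ,
      (∀ n, ContDiff ℝ ∞ (v n)) ∧
      Tendsto (fun n => eLpNorm (fun x => v n x - u x) 1 (volume.restrict Ω)) atTop (𝓝 0) ∧
      (∀ i, Tendsto (fun n => eLpNorm
        (fun x => fderiv ℝ (v n) x (EuclideanSpace.single i 1) - weakPartial Ω i u x) 1
          (volume.restrict Ω)) atTop (𝓝 0)) ∧
      Tendsto (fun n => eLpNorm (fun x => v n x - g x) 1 (surfaceMeasure Ω)) atTop (𝓝 0)

end MultiphaseShape

end

open MultiphaseShape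

/-!
The argument has two halves.

*The equation `div S₁ = S₀` and the volume formula need only test fields.* Let `φ` be a smooth
function with compact support in one phase `Ωₖ`, and `θ = φ eᵢ`. The flow of `θ` fixes every point
outside `Ωₖ` and, by uniqueness of integral curves forwards and backwards in time, maps `Ωₖ` onto
itself (`IsFlowOn.image_eq`). Hence the partition does not move, the shape derivative in the
direction `θ` is zero (`HasEulerianDeriv.eq_zero_of_support_subset`), and the tensor representation
reads `∫ (∑ⱼ S₁ᵢⱼ ∂ⱼφ + S₀ᵢ φ) = 0` over `Ωₖ`, that is `div S₁ = S₀` in `Ωₖ` (`weakDiv_ae_eq`). The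
product rule for a weak derivative and a `C¹` function (`HasWeakPartial.mul`) then gives
`S₁ : Dθ + S₀ · θ = div (S₁ᵀ θ)` almost everywhere in `Ωₖ` for every admissible `θ`, and the
integrals over the phases add up to the integral over `D` if the phases fill `D` up to a null set.

*The boundary formula needs the theory of traces on Lipschitz sets.* The area formula for the graph
of a Lipschitz function (`euclideanHausdorffMeasure_image_graphMap`) comes from Rademacher's
theorem: the domain is cut into pieces on which the function is close to a linear form, in the sense that the
difference has a small Lipschitz constant. Since the weight in the area formula is the length of the
gradient whose normalization is the outward normal (`outwardNormal_graphMap`), the divergence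
theorem over an epigraph is Fubini's theorem together with the vanishing of the integral of the
derivatives of a compactly supported Lipschitz function (`setIntegral_epigraph_fderiv`). A partition of unity
globalizes it to bounded Lipschitz sets (`IsLipschitzSet.setIntegral_fderiv`), together with the
trace inequality `‖u‖_{L¹(∂Ω)} ≤ C ‖u‖_{W^{1,1}(Ω)}`
(`IsLipschitzSet.exists_lintegral_surfaceMeasure_le`). Mollification with kernels translated into an
interior cone shows that functions smooth up to the boundary are dense in `W^{1,1}`
(`IsLipschitzSet.exists_smooth_approx`). Density and the trace inequality give the existence of
traces (`IsLipschitzSet.exists_isTrace`), and passing to the limit in the divergence theorem gives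
the integration by parts formula (`IsTrace.setIntegral_eq`), which turns the integral of
`S₁ : Dθ + S₀ · θ` over `Ωₖ` into the boundary integral of `(S₁ n) · θ`. Lipschitz boundaries are
null sets, so that the phases fill `D` up to a null set.
-/

set_option linter.unusedSectionVars false

namespace MultiphaseShape

/-! ### Graphs over a hyperplane -/

section Graph

variable {E : Type*} [NormedAddCommGroup E] [InnerProductSpace ℝ E]

/-- The hyperplane through the origin orthogonal to `e`. -/
noncomputable abbrev hyperplane (e : E) : Submodule ℝ E := (Submodule.span ℝ {e})ᗮ

theorem inner_hyperplane (e : E) (z : hyperplane e) : inner ℝ e (z : E) = 0 :=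
  Submodule.mem_orthogonal_singleton_iff_inner_right.1 z.2

/-- The graph parametrization `z ↦ z + γ(z) e` of a function `γ` on the hyperplane `e^⊥`. -/
noncomputable def graphMap (e : E) (γ : hyperplane e → ℝ) (z : hyperplane e) : E :=
  (z : E) + γ z • e

theorem norm_sq_add_smul {e : E} (he : ‖e‖ = 1) (z : hyperplane e) (s : ℝ) :
    ‖(z : E) + s • e‖ ^ 2 = ‖z‖ ^ 2 + s ^ 2 := by
  have h : inner ℝ (z : E) (s • e) = 0 := by
    rw [inner_smul_right, real_inner_comm, inner_hyperplane, mul_zero]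
  rw [norm_add_sq_real, h, norm_smul, he]
  simp

theorem norm_le_norm_add_smul {e : E} (he : ‖e‖ = 1) (z : hyperplane e) (s : ℝ) :
    ‖z‖ ≤ ‖(z : E) + s • e‖ := by
  have := norm_sq_add_smul he z s
  exact abs_le_of_sq_le_sq' (by nlinarith [sq_nonneg s]) (norm_nonneg _) |>.2

theorem graphMap_sub (e : E) (γ : hyperplane e → ℝ) (z w : hyperplane e) :
    graphMap e γ z - graphMap e γ w = ((z - w : hyperplane e) : E) + (γ z - γ w) • e := by
  simp only [graphMap, Submodule.coe_sub, sub_smul]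
  abel

theorem norm_sub_le_norm_graphMap_sub {e : E} (he : ‖e‖ = 1) (γ : hyperplane e → ℝ)
    (z w : hyperplane e) : ‖z - w‖ ≤ ‖graphMap e γ z - graphMap e γ w‖ := by
  rw [graphMap_sub]
  exact norm_le_norm_add_smul he _ _

theorem graphMap_injective {e : E} (he : ‖e‖ = 1) (γ : hyperplane e → ℝ) :
    Function.Injective (graphMap e γ) := fun z w h => by
  have := norm_sub_le_norm_graphMap_sub he γ z w
  rw [h, sub_self, norm_zero] at this
  exact sub_eq_zero.1 (norm_le_zero_iff.1 this)

theorem LipschitzWith.graphMap {e : E} (he : ‖e‖ = 1) {γ : hyperplane e → ℝ} {K : ℝ≥0}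
    (hγ : LipschitzWith K γ) : LipschitzWith (1 + K) (graphMap e γ) := by
  refine LipschitzWith.of_dist_le_mul fun z w => ?_
  have h := hγ.dist_le_mul z w
  rw [dist_eq_norm, Real.norm_eq_abs, dist_eq_norm] at h
  rw [dist_eq_norm, dist_eq_norm, graphMap_sub]
  refine (norm_add_le _ _).trans ?_
  rw [norm_smul, he, Real.norm_eq_abs, NNReal.coe_add, NNReal.coe_one, add_mul, one_mul, mul_one]
  exact add_le_add le_rfl h

theorem isClosedEmbedding_graphMap [FiniteDimensional ℝ E] {e : E} (he : ‖e‖ = 1)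
    {γ : hyperplane e → ℝ} {K : ℝ≥0} (hγ : LipschitzWith K γ) :
    IsClosedEmbedding (graphMap e γ) := by
  have hanti : AntilipschitzWith 1 (graphMap e γ) := AntilipschitzWith.of_le_mul_dist fun z w => by
    simpa [dist_eq_norm] using norm_sub_le_norm_graphMap_sub he γ z w
  exact hanti.isClosedEmbedding (hγ.graphMap he).uniformContinuous

variable [FiniteDimensional ℝ E]

/-- The graph of a linear form `L` over `e^⊥` has volume factor `√(1 + ‖L‖²)`: the Gram operator of
its parametrization is the transvection `z ↦ z + L z • ∇L`, of determinant `1 + ‖L‖²`. -/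
theorem normDet_graphMap_linear {e : E} (he : ‖e‖ = 1) (L : hyperplane e →L[ℝ] ℝ) :
    ((hyperplane e).subtype + L.toLinearMap.smulRight e).normDet = √(1 + ‖L‖ ^ 2) := by
  set f : hyperplane e →ₗ[ℝ] E := (hyperplane e).subtype + L.toLinearMap.smulRight e with hf
  set l := (InnerProductSpace.toDual ℝ (hyperplane e)).symm L with hl
  have hLl : ∀ z, inner ℝ l z = L z := fun z => by
    rw [hl, InnerProductSpace.toDual_symm_apply]
  have hcomp : f.adjoint ∘ₗ f = LinearMap.transvection L.toLinearMap l := by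
    refine LinearMap.ext fun z => ext_inner_right ℝ fun w => ?_
    rw [LinearMap.comp_apply, LinearMap.adjoint_inner_left]
    have h1 : inner ℝ (z : E) e = 0 := by rw [real_inner_comm, inner_hyperplane]
    have h2 : inner ℝ e (w : E) = 0 := inner_hyperplane e w
    have h3 : inner ℝ e e = (1 : ℝ) := by rw [real_inner_self_eq_norm_sq, he, one_pow]
    simp only [hf, LinearMap.add_apply, Submodule.subtype_apply, LinearMap.smulRight_apply,
      ContinuousLinearMap.coe_coe, inner_add_left, inner_add_right, inner_smul_left,
      inner_smul_right, h1, h2, h3, LinearMap.transvection, LinearMap.coe_mk, AddHom.coe_mk, hLl,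
      Submodule.coe_inner]
    simp [mul_comm]
  have hsq : f.normDet ^ 2 = 1 + ‖L‖ ^ 2 := by
    have h := f.normDet_sq
    rw [hcomp, LinearMap.transvection.det] at h
    have h4 : L l = ‖L‖ ^ 2 := by
      rw [← hLl, real_inner_self_eq_norm_sq, hl, LinearIsometryEquiv.norm_map]
    simpa [h4] using h
  rw [← hsq, Real.sqrt_sq f.normDet_nonneg]

variable [MeasurableSpace E] [BorelSpace E]

theorem euclideanHausdorffMeasure_graphMap_linear {e : E} (he : ‖e‖ = 1)
    (L : hyperplane e →L[ℝ] ℝ) (A : Set (hyperplane e)) :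
    μHE[Module.finrank ℝ (hyperplane e)] (graphMap e L '' A) =
      ENNReal.ofReal √(1 + ‖L‖ ^ 2) * volume A := by
  rw [← normDet_graphMap_linear he,
    ← LinearMap.euclideanHausdorffMeasure_image_eq_normDet_mul_volume]
  rfl

theorem euclideanHausdorffMeasure_image_le {X Y : Type*} [EMetricSpace X] [MeasurableSpace X]
    [BorelSpace X] [EMetricSpace Y] [MeasurableSpace Y] [BorelSpace Y] {f : X → Y} {K : ℝ≥0}
    {s : Set X} (hf : LipschitzOnWith K f s) (n : ℕ) :
    μHE[n] (f '' s) ≤ (K : ℝ≥0∞) ^ n * μHE[n] s := by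
  have h := hf.hausdorffMeasure_image_le (d := n) (Nat.cast_nonneg n)
  rw [ENNReal.rpow_natCast] at h
  simp only [Measure.euclideanHausdorffMeasure_def, Measure.smul_apply, ENNReal.smul_def,
    smul_eq_mul]
  rw [mul_left_comm]
  gcongr

omit [FiniteDimensional ℝ E] in
/-- On a set on which `γ₁ - γ₂` is `δ`-Lipschitz, the graphs of `γ₁` and `γ₂` are related by a
`(1 + δ)`-Lipschitz map. -/
theorem euclideanHausdorffMeasure_graphMap_le {e : E} (he : ‖e‖ = 1) {γ₁ γ₂ : hyperplane e → ℝ}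
    {δ : ℝ≥0} {A : Set (hyperplane e)}
    (h : ∀ z ∈ A, ∀ w ∈ A, |(γ₁ z - γ₁ w) - (γ₂ z - γ₂ w)| ≤ δ * ‖z - w‖) (n : ℕ) :
    μHE[n] (graphMap e γ₁ '' A) ≤ ((1 + δ : ℝ≥0) : ℝ≥0∞) ^ n * μHE[n] (graphMap e γ₂ '' A) := by
  have hinv : Function.LeftInverse (Function.invFun (graphMap e γ₂)) (graphMap e γ₂) :=
    Function.leftInverse_invFun (graphMap_injective he γ₂)
  have heq : graphMap e γ₁ '' A =
      (graphMap e γ₁ ∘ Function.invFun (graphMap e γ₂)) '' (graphMap e γ₂ '' A) := by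
    rw [image_image]
    exact image_congr fun z _ => by simp [hinv z]
  rw [heq]
  refine euclideanHausdorffMeasure_image_le (LipschitzOnWith.of_dist_le_mul ?_) n
  rintro _ ⟨z, hz, rfl⟩ _ ⟨w, hw, rfl⟩
  simp only [Function.comp_apply, hinv z, hinv w, dist_eq_norm]
  have hdec : graphMap e γ₁ z - graphMap e γ₁ w =
      (graphMap e γ₂ z - graphMap e γ₂ w) + ((γ₁ z - γ₁ w) - (γ₂ z - γ₂ w)) • e := by
    rw [graphMap_sub, graphMap_sub, sub_smul _ (γ₂ z - γ₂ w)]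
    abel
  rw [hdec]
  refine (norm_add_le _ _).trans ?_
  rw [norm_smul, he, mul_one, Real.norm_eq_abs]
  have h1 := h z hz w hw
  have h2 := mul_le_mul_of_nonneg_left (norm_sub_le_norm_graphMap_sub he γ₂ z w) δ.2
  have h3 : ((1 + δ : ℝ≥0) : ℝ) = 1 + δ := by push_cast; rfl
  rw [h3, add_mul, one_mul]
  exact add_le_add le_rfl (h1.trans h2)

theorem sqrt_one_add_sq_le {a b δ : ℝ} (ha : 0 ≤ a) (hb : 0 ≤ b) (hδ : 0 ≤ δ) (h : a ≤ b + δ) :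
    √(1 + a ^ 2) ≤ (1 + δ) * √(1 + b ^ 2) := by
  have h1 : 1 ≤ √(1 + b ^ 2) := Real.one_le_sqrt.2 (by nlinarith)
  have h2 : b ≤ √(1 + b ^ 2) := Real.le_sqrt_of_sq_le (by linarith)
  rw [Real.sqrt_le_left (by positivity), mul_pow, Real.sq_sqrt (by positivity)]
  nlinarith [mul_nonneg hδ hb, sq_nonneg (b - 1), mul_nonneg hδ (sq_nonneg (b - 1)),
    mul_nonneg (mul_nonneg hδ hδ) (sq_nonneg b)]

/-- If a real function is approximated by the linear form `L` on a set, then its derivative is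
almost everywhere close to `L` there. -/
theorem ApproximatesLinearOn.norm_fderiv_sub_le_real {H : Type*} [NormedAddCommGroup H]
    [InnerProductSpace ℝ H] [FiniteDimensional ℝ H] [MeasurableSpace H] [BorelSpace H]
    {γ : H → ℝ} {L : H →L[ℝ] ℝ} {s : Set H} {δ : ℝ≥0} (hs : MeasurableSet s)
    (h : ApproximatesLinearOn γ L s δ) (hd : ∀ z ∈ s, DifferentiableAt ℝ γ z) :
    ∀ᵐ z ∂(volume.restrict s), ‖fderiv ℝ γ z - L‖ ≤ δ := by
  rcases subsingleton_or_nontrivial H with hH | hH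
  · refine ae_of_all _ fun z => ?_
    have : fderiv ℝ γ z - L = 0 := by
      ext w; rw [Subsingleton.elim w 0]; simp
    rw [this, norm_zero]; exact δ.2
  obtain ⟨u, hu⟩ := exists_norm_eq H zero_le_one
  -- pass to a map with values in `H`, to which the equidimensional result applies
  have happ : ApproximatesLinearOn (fun z => γ z • u) (L.smulRight u) s δ := by
    intro z hz w hw
    have := h z hz w hw
    rw [ContinuousLinearMap.smulRight_apply, ← sub_smul, ← sub_smul, norm_smul, hu, mul_one]
    exact this
  filter_upwards [happ.norm_fderiv_sub_le volume hs (fun z => (fderiv ℝ γ z).smulRight u)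
    (fun z hz => ((hd z hz).hasFDerivAt.smul_const u).hasFDerivWithinAt)] with z hz
  have h1 : (fderiv ℝ γ z).smulRight u - L.smulRight u = (fderiv ℝ γ z - L).smulRight u := by
    ext w; simp [sub_smul]
  rw [h1] at hz
  have h2 : ‖(fderiv ℝ γ z - L).smulRight u‖ ≤ δ := hz
  rwa [ContinuousLinearMap.norm_smulRight_apply, hu, mul_one] at h2

/-- The surface element `√(1 + |∇γ|²)` of the graph of `γ`. -/
noncomputable def graphDensity {e : E} (γ : hyperplane e → ℝ) (z : hyperplane e) : ℝ :=
  √(1 + ‖fderiv ℝ γ z‖ ^ 2)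

omit [FiniteDimensional ℝ E] in
theorem measurable_graphDensity {e : E} (γ : hyperplane e → ℝ) :
    Measurable (graphDensity γ) := by
  unfold graphDensity
  exact (((measurable_fderiv ℝ γ).norm.pow_const 2).const_add 1).sqrt

/-! ### The area formula for Lipschitz graphs -/

section Area

variable {e : E} {γ : hyperplane e → ℝ}

/-- The area formula up to a factor close to one, over a set on which `γ` is close to a linear
form. -/
theorem euclideanHausdorffMeasure_graphMap_le_of_approximatesLinearOn (he : ‖e‖ = 1)
    {L : hyperplane e →L[ℝ] ℝ} {δ : ℝ≥0} {B : Set (hyperplane e)} (hB : MeasurableSet B)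
    (h : ApproximatesLinearOn γ L B δ) (hd : ∀ z ∈ B, DifferentiableAt ℝ γ z) :
    μHE[Module.finrank ℝ (hyperplane e)] (graphMap e γ '' B) ≤
        ((1 + δ : ℝ≥0) : ℝ≥0∞) ^ (Module.finrank ℝ (hyperplane e) + 1) *
          ∫⁻ z in B, ENNReal.ofReal (graphDensity γ z) ∧
      ∫⁻ z in B, ENNReal.ofReal (graphDensity γ z) ≤
        ((1 + δ : ℝ≥0) : ℝ≥0∞) ^ (Module.finrank ℝ (hyperplane e) + 1) *
          μHE[Module.finrank ℝ (hyperplane e)] (graphMap e γ '' B) := by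
  have hclose := h.norm_fderiv_sub_le_real hB hd
  have hlip : ∀ z ∈ B, ∀ w ∈ B, |(γ z - γ w) - (L z - L w)| ≤ δ * ‖z - w‖ := fun z hz w hw => by
    rw [← map_sub]; exact h z hz w hw
  have hlip' : ∀ z ∈ B, ∀ w ∈ B, |(L z - L w) - (γ z - γ w)| ≤ δ * ‖z - w‖ := fun z hz w hw => by
    rw [abs_sub_comm]; exact hlip z hz w hw
  have hlin := euclideanHausdorffMeasure_graphMap_linear he L B
  have hc : ((1 + δ : ℝ≥0) : ℝ≥0∞) = ENNReal.ofReal (1 + δ) := by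
    rw [← ENNReal.ofReal_coe_nnreal]; push_cast; rfl
  have hint : ∫⁻ _ in B, ENNReal.ofReal √(1 + ‖L‖ ^ 2) =
      ENNReal.ofReal √(1 + ‖L‖ ^ 2) * volume B := by rw [setLIntegral_const]
  constructor
  · refine (euclideanHausdorffMeasure_graphMap_le he hlip _).trans ?_
    rw [hlin, ← hint, pow_succ _ (Module.finrank ℝ (hyperplane e)), mul_assoc,
      ← lintegral_const_mul' _ _ ENNReal.coe_ne_top]
    refine mul_le_mul_right (lintegral_mono_ae ?_) _
    filter_upwards [hclose] with z hz
    rw [graphDensity, hc, ← ENNReal.ofReal_mul (by positivity)]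
    refine ENNReal.ofReal_le_ofReal (sqrt_one_add_sq_le (by positivity) (by positivity) δ.2 ?_)
    rw [norm_sub_rev] at hz
    linarith [norm_le_norm_add_norm_sub' L (fderiv ℝ γ z)]
  · rw [pow_succ' _ (Module.finrank ℝ (hyperplane e)), mul_assoc]
    refine le_trans ?_ (mul_le_mul_right (euclideanHausdorffMeasure_graphMap_le he hlip' _) _)
    rw [hlin, ← hint, ← lintegral_const_mul' _ _ ENNReal.coe_ne_top]
    refine lintegral_mono_ae ?_
    filter_upwards [hclose] with z hz
    rw [graphDensity, hc, ← ENNReal.ofReal_mul (by positivity)]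
    refine ENNReal.ofReal_le_ofReal (sqrt_one_add_sq_le (by positivity) (by positivity) δ.2 ?_)
    linarith [norm_le_norm_add_norm_sub' (fderiv ℝ γ z) L]

/-- A bound between two measures on the pieces of a countable partition of a set of full measure
gives the same bound on all measurable sets. -/
theorem measure_le_mul_of_partition {α : Type*} [MeasurableSpace α] {μ ν ρ : Measure α}
    (hμ : μ ≪ ρ) {A S : Set α} (hA : MeasurableSet A) (hS : MeasurableSet S) (hSρ : ρ Sᶜ = 0)
    {t : ℕ → Set α} (ht : Pairwise (Function.onFun Disjoint t)) (htm : ∀ n, MeasurableSet (t n))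
    (hSt : S ⊆ ⋃ n, t n) {c : ℝ≥0∞} (h : ∀ n, μ (A ∩ S ∩ t n) ≤ c * ν (A ∩ S ∩ t n)) :
    μ A ≤ c * ν A := by
  have h1 : ∀ ξ : Measure α, ξ (A ∩ S) = ∑' n, ξ (A ∩ S ∩ t n) := fun ξ => by
    rw [← measure_iUnion (fun i j hij => (ht hij).mono inter_subset_right inter_subset_right)
      (fun n => (hA.inter hS).inter (htm n)), ← inter_iUnion,
      inter_eq_left.2 (inter_subset_right.trans hSt)]
  have h2 : μ A ≤ μ (A ∩ S) := by
    refine (measure_le_inter_add_sdiff μ A S).trans ?_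
    rw [measure_mono_null (sdiff_subset_compl A S) (hμ hSρ), add_zero]
  refine h2.trans ?_
  rw [h1 μ]
  calc ∑' n, μ (A ∩ S ∩ t n) ≤ ∑' n, c * ν (A ∩ S ∩ t n) := ENNReal.tsum_le_tsum h
    _ = c * ν (A ∩ S) := by rw [ENNReal.tsum_mul_left, h1 ν]
    _ ≤ c * ν A := by gcongr; exact inter_subset_left

theorem le_of_forall_le_one_add_pow_mul {a b : ℝ≥0∞} {n : ℕ}
    (h : ∀ δ : ℝ≥0, δ ≠ 0 → a ≤ ((1 + δ : ℝ≥0) : ℝ≥0∞) ^ n * b) : a ≤ b := by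
  have hlim : Tendsto (fun δ : ℝ≥0 => ((1 + δ : ℝ≥0) : ℝ≥0∞) ^ n * b) (𝓝[≠] 0) (𝓝 (1 * b)) := by
    refine ENNReal.Tendsto.mul_const ?_ (Or.inl one_ne_zero)
    have hc : Continuous fun δ : ℝ≥0 => ((1 + δ : ℝ≥0) : ℝ≥0∞) ^ n :=
      (ENNReal.continuous_pow n).comp (ENNReal.continuous_coe.comp (by fun_prop))
    have := (hc.tendsto 0).mono_left (nhdsWithin_le_nhds (s := {0}ᶜ))
    simpa using this
  rw [one_mul] at hlim
  exact ge_of_tendsto hlim (eventually_nhdsWithin_of_forall h)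

/-- **Area formula for Lipschitz graphs.** Up to factors close to one, the graph over a small piece
has the same measure as that of a linear form, since the two graphs are bi-Lipschitz with constants
close to one. -/
theorem euclideanHausdorffMeasure_image_graphMap (he : ‖e‖ = 1) {K : ℝ≥0}
    (hγ : LipschitzWith K γ) {A : Set (hyperplane e)} (hA : MeasurableSet A) :
    μHE[Module.finrank ℝ (hyperplane e)] (graphMap e γ '' A) =
      ∫⁻ z in A, ENNReal.ofReal (graphDensity γ z) := by
  set m := Module.finrank ℝ (hyperplane e)
  have hemb := (isClosedEmbedding_graphMap he hγ).measurableEmbedding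
  set μ : Measure (hyperplane e) := (μHE[m] : Measure E).comap (graphMap e γ) with hμdef
  set ν : Measure (hyperplane e) := volume.withDensity fun z => ENNReal.ofReal (graphDensity γ z)
    with hνdef
  have hμ : ∀ B, μ B = μHE[m] (graphMap e γ '' B) := fun B => hemb.comap_apply _ _
  have hν : ∀ B, MeasurableSet B → ν B = ∫⁻ z in B, ENNReal.ofReal (graphDensity γ z) :=
    fun B hB => withDensity_apply _ hB
  have hμvol : μ ≪ volume := fun B hB => by
    have h := euclideanHausdorffMeasure_image_le ((hγ.graphMap he).lipschitzOnWith (s := B)) m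
    rw [InnerProductSpace.euclideanHausdorffMeasure_eq_volume, hB, mul_zero] at h
    rw [hμ]
    exact le_antisymm h zero_le
  have hνvol : ν ≪ volume := withDensity_absolutelyContinuous _ _
  set S := {z | DifferentiableAt ℝ γ z} with hSdef
  have hS : MeasurableSet S := measurableSet_of_differentiableAt ℝ γ
  have hS0 : volume Sᶜ = 0 := hγ.ae_differentiableAt
  have key : ∀ δ : ℝ≥0, δ ≠ 0 → μ A ≤ ((1 + δ : ℝ≥0) : ℝ≥0∞) ^ (m + 1) * ν A ∧
      ν A ≤ ((1 + δ : ℝ≥0) : ℝ≥0∞) ^ (m + 1) * μ A := by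
    intro δ hδ
    obtain ⟨t, L, htd, htm, hSt, happ, -⟩ :=
      exists_partition_approximatesLinearOn_of_hasFDerivWithinAt γ S (fderiv ℝ γ)
        (fun z hz => (DifferentiableAt.hasFDerivAt hz).hasFDerivWithinAt) (fun _ => δ)
        (fun _ => hδ)
    have hpiece := fun n => euclideanHausdorffMeasure_graphMap_le_of_approximatesLinearOn he
      ((hA.inter hS).inter (htm n))
      ((happ n).mono_set (inter_subset_inter_left _ inter_subset_right))
      (fun z hz => hz.1.2)
    constructor
    · refine measure_le_mul_of_partition hμvol hA hS hS0 htd htm hSt fun n => ?_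
      rw [hμ, hν _ ((hA.inter hS).inter (htm n))]
      exact (hpiece n).1
    · refine measure_le_mul_of_partition hνvol hA hS hS0 htd htm hSt fun n => ?_
      rw [hμ, hν _ ((hA.inter hS).inter (htm n))]
      exact (hpiece n).2
  rw [← hμ, ← hν A hA]
  exact le_antisymm (le_of_forall_le_one_add_pow_mul fun δ hδ => (key δ hδ).1)
    (le_of_forall_le_one_add_pow_mul fun δ hδ => (key δ hδ).2)

/-- Surface measure on the graph, parametrized by the hyperplane. -/
theorem euclideanHausdorffMeasure_restrict_range_graphMap (he : ‖e‖ = 1) {K : ℝ≥0}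
    (hγ : LipschitzWith K γ) :
    (μHE[Module.finrank ℝ (hyperplane e)]).restrict (range (graphMap e γ)) =
      (volume.withDensity fun z => ENNReal.ofReal (graphDensity γ z)).map (graphMap e γ) := by
  have hemb := (isClosedEmbedding_graphMap he hγ).measurableEmbedding
  ext B hB
  rw [hemb.map_apply, withDensity_apply _ (hemb.measurable hB), Measure.restrict_apply hB,
    ← euclideanHausdorffMeasure_image_graphMap he hγ (hemb.measurable hB),
    image_preimage_eq_inter_range]

end Area

end Graph

/-! ### Coordinates adapted to a hyperplane -/

section Coordinates

variable {E : Type*} [NormedAddCommGroup E] [InnerProductSpace ℝ E] [FiniteDimensional ℝ E]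

/-- The orthogonal projection on the hyperplane `e^⊥`. -/
noncomputable abbrev hyperplaneProj (e : E) : E →L[ℝ] hyperplane e :=
  (hyperplane e).orthogonalProjectionOnto

omit [FiniteDimensional ℝ E] in
theorem coe_hyperplaneProj {e : E} (he : ‖e‖ = 1) (y : E) :
    (hyperplaneProj e y : E) = y - inner ℝ e y • e := by
  have h := Submodule.starProjection_orthogonal_val (𝕜 := ℝ) (K := Submodule.span ℝ {e}) y
  rw [Submodule.starProjection_unit_singleton ℝ he] at h
  exact h

omit [FiniteDimensional ℝ E] in
theorem hyperplaneProj_add_smul {e : E} (he : ‖e‖ = 1) (z : hyperplane e) (s : ℝ) :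
    hyperplaneProj e ((z : E) + s • e) = z := by
  apply Subtype.ext
  rw [coe_hyperplaneProj he, inner_add_right, inner_smul_right, inner_hyperplane,
    real_inner_self_eq_norm_sq, he]
  simp

omit [FiniteDimensional ℝ E] in
theorem inner_add_smul {e : E} (he : ‖e‖ = 1) (z : hyperplane e) (s : ℝ) :
    inner ℝ e ((z : E) + s • e) = s := by
  rw [inner_add_right, inner_smul_right, inner_hyperplane, real_inner_self_eq_norm_sq, he]
  simp

theorem finrank_hyperplane {e : E} (he : ‖e‖ = 1) :
    Module.finrank ℝ (hyperplane e) = Module.finrank ℝ E - 1 := by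
  have h := (Submodule.span ℝ {e}).finrank_add_finrank_orthogonal
  have he0 : e ≠ 0 := fun h0 => by simp [h0] at he
  rw [finrank_span_singleton he0] at h
  unfold hyperplane
  omega

/-- The upward shift of the graph of `γ`, as a map of the product `e^⊥ × ℝ`. -/
noncomputable def graphShear (e : E) (γ : hyperplane e → ℝ) (p : hyperplane e × ℝ) : E :=
  graphMap e γ p.1 + p.2 • e

/-- Lebesgue measure on `E` is the product of the measures on `e^⊥` and on the vertical lines, also
after a vertical shift depending on the point of `e^⊥`. -/
theorem measurePreserving_graphShear [MeasurableSpace E] [BorelSpace E] {e : E} (he : ‖e‖ = 1)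
    {γ : hyperplane e → ℝ} (hγ : Measurable γ) :
    MeasurePreserving (graphShear e γ) (volume.prod volume) volume := by
  have h1 : MeasurePreserving (LinearIsometryEquiv.toSpanUnitSingleton (𝕜 := ℝ) e he)
      volume volume := LinearIsometryEquiv.measurePreserving _
  have h2 : MeasurePreserving (fun p : hyperplane e × ℝ => (p.1, γ p.1 + p.2))
      (volume.prod volume) (volume.prod volume) := by
    refine (MeasurePreserving.id volume).skew_product (g := fun z s => γ z + s) ?_ ?_
    · exact (hγ.comp measurable_fst).add measurable_snd
    · exact ae_of_all _ fun z => map_add_left_eq_self _ _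
  have h3 := (Submodule.measurePreserving_measurableEquivProd (Submodule.span ℝ {e}) (0 : E)).symm
  rw [InnerProductSpace.euclideanHausdorffMeasure_eq_volume] at h3
  have h4 : MeasurePreserving (Prod.swap : hyperplane e × Submodule.span ℝ {e} → _)
      (volume.prod volume) (volume.prod volume) := Measure.measurePreserving_swap
  have h5 := (MeasurePreserving.id (volume : Measure (hyperplane e))).prod h1
  have h6 := h3.comp (h4.comp (h5.comp h2))
  refine (congrArg (fun f => MeasurePreserving f (volume.prod volume) volume) ?_).mpr h6
  funext p
  simp [graphShear, graphMap, Submodule.measurableEquivProd_symm_apply, add_smul]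
  abel

end Coordinates

/-! ### The outward normal -/

section Normal

/-- `ℝᵈ` with its Euclidean structure. -/
abbrev Euc (d : ℕ) : Type := EuclideanSpace ℝ (Fin d)

variable {d : ℕ} {Ω : Set (Euc d)} {x : Euc d}

theorem IsOutwardUnitNormal.unique {ν ν' : Euc d} (h : IsOutwardUnitNormal Ω x ν)
    (h' : IsOutwardUnitNormal Ω x ν') : ν = ν' := by
  by_contra hne
  -- along `ν' - ν` the two cone conditions contradict each other
  set v := ν' - ν with hv
  have hv0 : 0 < ‖v‖ := norm_pos_iff.2 (sub_ne_zero.2 (Ne.symm hne))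
  have hself : inner ℝ ν ν = (1 : ℝ) := by rw [real_inner_self_eq_norm_sq, h.1, one_pow]
  have hself' : inner ℝ ν' ν' = (1 : ℝ) := by rw [real_inner_self_eq_norm_sq, h'.1, one_pow]
  set a := 1 - inner ℝ ν' ν with ha
  have hva : inner ℝ v ν = -a := by rw [hv, inner_sub_left, hself, ha]; ring
  have hva' : inner ℝ v ν' = a := by
    rw [hv, inner_sub_left, hself', ha, real_inner_comm ν' ν]
  have hapos : 0 < a := by
    have h1 : ‖v‖ ^ 2 = 2 * a := by
      rw [← real_inner_self_eq_norm_sq]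
      nth_rw 2 [hv]
      rw [inner_sub_right, hva, hva']
      ring
    nlinarith
  set ε := a / (2 * ‖v‖) with hε
  have hεpos : 0 < ε := by positivity
  have hεv : ε * ‖v‖ = a / 2 := by rw [hε]; field_simp
  obtain ⟨δ, hδ, H⟩ := h.2 ε hεpos
  obtain ⟨δ', hδ', H'⟩ := h'.2 ε hεpos
  set t := min δ δ' / (2 * ‖v‖) with ht
  have hmin : 0 < min δ δ' := lt_min hδ hδ'
  have htpos : 0 < t := by positivity
  have htv : t * ‖v‖ = min δ δ' / 2 := by rw [ht]; field_simp
  have hnorm : ‖t • v‖ = t * ‖v‖ := by rw [norm_smul, Real.norm_eq_abs, abs_of_pos htpos]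
  have hmem : ∀ r, min δ δ' ≤ r → x + t • v ∈ Metric.ball x r := fun r hr => by
    rw [mem_ball_iff_norm, add_sub_cancel_left, hnorm, htv]
    linarith
  have hin : x + t • v ∈ Ω := by
    refine (H _ (hmem _ (min_le_left _ _))).1 ?_
    rw [add_sub_cancel_left, hnorm, inner_smul_left, hva]
    simp only [conj_trivial]
    nlinarith
  refine (H' _ (hmem _ (min_le_right _ _))).2 ?_ hin
  rw [add_sub_cancel_left, hnorm, inner_smul_left, hva']
  simp only [conj_trivial]
  nlinarith

theorem IsOutwardUnitNormal.outwardNormal_eq {ν : Euc d} (h : IsOutwardUnitNormal Ω x ν) :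
    outwardNormal Ω x = ν := by
  have hex : ∃ ν, IsOutwardUnitNormal Ω x ν := ⟨ν, h⟩
  rw [outwardNormal, dif_pos hex]
  exact hex.choose_spec.unique h

theorem norm_outwardNormal_le (Ω : Set (Euc d)) (x : Euc d) : ‖outwardNormal Ω x‖ ≤ 1 := by
  rw [outwardNormal]
  split_ifs with h
  · exact h.choose_spec.1.le
  · simp

/-- The outward unit normal of a sublevel set of a function with nonzero gradient. -/
theorem isOutwardUnitNormal_of_hasFDerivAt {F : Euc d → ℝ} {w : Euc d}
    (hF : HasFDerivAt F (innerSL ℝ w) x) (hFx : F x = 0) (hw : w ≠ 0)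
    (hΩ : ∀ᶠ y in 𝓝 x, y ∈ Ω ↔ F y < 0) : IsOutwardUnitNormal Ω x (‖w‖⁻¹ • w) := by
  have hw0 : 0 < ‖w‖ := norm_pos_iff.2 hw
  refine ⟨by rw [norm_smul, norm_inv, norm_norm, inv_mul_cancel₀ hw0.ne'], fun ε hε => ?_⟩
  have hev := (hF.isLittleO.def (mul_pos hε hw0)).and hΩ
  obtain ⟨δ, hδ, H⟩ := Metric.eventually_nhds_iff_ball.1 hev
  refine ⟨δ, hδ, fun y hy => ?_⟩
  obtain ⟨h1, h2⟩ := H y hy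
  rw [hFx, sub_zero, innerSL_apply_apply, Real.norm_eq_abs, abs_le] at h1
  have h3 : inner ℝ (y - x) (‖w‖⁻¹ • w) = ‖w‖⁻¹ * inner ℝ w (y - x) := by
    rw [inner_smul_right, real_inner_comm]
  have h4 : ‖w‖ * (‖w‖⁻¹ * inner ℝ w (y - x)) = inner ℝ w (y - x) := by field_simp
  rw [h3]
  constructor
  · intro h
    rw [h2]
    nlinarith [mul_lt_mul_of_pos_left h hw0]
  · intro h
    rw [h2, not_lt]
    nlinarith [mul_lt_mul_of_pos_left h hw0]

/-- The gradient `∇γ - e` of `y ↦ γ(Py) - ⟨e, y⟩`, a function which vanishes on the graph of `γ`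
and is negative above it. -/
noncomputable def graphGradient {e : Euc d} (γ : hyperplane e → ℝ) (z : hyperplane e) : Euc d :=
  ((InnerProductSpace.toDual ℝ (hyperplane e)).symm (fderiv ℝ γ z) : Euc d) - e

variable {e : Euc d} {γ : hyperplane e → ℝ}

theorem inner_graphGradient (γ : hyperplane e → ℝ) (z : hyperplane e) (v : Euc d) :
    inner ℝ (graphGradient γ z) v = fderiv ℝ γ z (hyperplaneProj e v) - inner ℝ e v := by
  rw [graphGradient, inner_sub_left, ← Submodule.inner_orthogonalProjectionOnto_eq_of_mem_left,
    InnerProductSpace.toDual_symm_apply]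

theorem norm_graphGradient (he : ‖e‖ = 1) (γ : hyperplane e → ℝ) (z : hyperplane e) :
    ‖graphGradient γ z‖ = graphDensity γ z := by
  have h := norm_sq_add_smul he ((InnerProductSpace.toDual ℝ (hyperplane e)).symm (fderiv ℝ γ z))
    (-1)
  rw [LinearIsometryEquiv.norm_map, neg_one_smul, ← sub_eq_add_neg] at h
  rw [graphGradient, graphDensity, ← Real.sqrt_sq (norm_nonneg _), h]
  congr 1
  ring

theorem graphDensity_pos (γ : hyperplane e → ℝ) (z : hyperplane e) : 0 < graphDensity γ z :=
  Real.sqrt_pos.2 (by positivity)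

theorem measurable_inner_graphGradient (γ : hyperplane e → ℝ) (v : Euc d) :
    Measurable fun z => inner ℝ (graphGradient γ z) v := by
  simp only [inner_graphGradient]
  exact (measurable_fderiv_apply_const ℝ γ _).sub_const _

theorem graphDensity_le {K : ℝ≥0} (hγ : LipschitzWith K γ) (z : hyperplane e) :
    graphDensity γ z ≤ 1 + K := by
  have h := norm_fderiv_le_of_lipschitz ℝ hγ (x₀ := z)
  rw [graphDensity, Real.sqrt_le_left (by positivity)]
  nlinarith [norm_nonneg (fderiv ℝ γ z), K.2, pow_le_pow_left₀ (norm_nonneg (fderiv ℝ γ z)) h 2]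

/-- At a differentiability point of the local graph, the outward normal is the normalized
gradient. -/
theorem outwardNormal_graphMap {r : ℝ} {γ : Euc d → ℝ} (hΩ : IsLocalEpigraph Ω x e r γ)
    {z : hyperplane e} (hz : DifferentiableAt ℝ (fun z : hyperplane e => γ z) z)
    (hzx : graphMap e (fun z : hyperplane e => γ z) z ∈ Metric.ball x r) :
    outwardNormal Ω (graphMap e (fun z : hyperplane e => γ z) z) =
      (graphDensity (fun z : hyperplane e => γ z) z)⁻¹ •
        graphGradient (fun z : hyperplane e => γ z) z := by
  obtain ⟨he, -, hepi⟩ := hΩ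
  set g : hyperplane e → ℝ := fun z => γ z with hg
  have hP : hyperplaneProj e (graphMap e g z) = z := hyperplaneProj_add_smul he _ _
  have hF : HasFDerivAt (fun y => g (hyperplaneProj e y) - inner ℝ e y)
      (innerSL ℝ (graphGradient g z)) (graphMap e g z) := by
    have h1 : HasFDerivAt g (fderiv ℝ g z) (hyperplaneProj e (graphMap e g z)) := by
      rw [hP]; exact hz.hasFDerivAt
    have h2 := (h1.comp _ (hyperplaneProj e).hasFDerivAt).sub
      (innerSL ℝ e).hasFDerivAt
    refine h2.congr_fderiv (ContinuousLinearMap.ext fun v => ?_)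
    rw [innerSL_apply_apply, inner_graphGradient]
    rfl
  have h0 : graphGradient g z ≠ 0 := by
    rw [← norm_pos_iff, norm_graphGradient he]; exact graphDensity_pos _ _
  rw [← norm_graphGradient he]
  refine (isOutwardUnitNormal_of_hasFDerivAt hF ?_ h0 ?_).outwardNormal_eq
  · rw [hP, graphMap, inner_add_smul he, sub_self]
  · filter_upwards [Metric.isOpen_ball.mem_nhds hzx] with y hy
    rw [hepi y hy, sub_neg, hg]
    simp only [coe_hyperplaneProj he]

end Normal

/-! ### Integrals over an epigraph and along its graph -/

section GraphIntegrals

variable {E : Type*} [NormedAddCommGroup E] [InnerProductSpace ℝ E] [FiniteDimensional ℝ E]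
  {e : E} {γ : hyperplane e → ℝ}

/-- The strict epigraph of `γ` in the direction `e`. -/
def epigraph (e : E) (γ : hyperplane e → ℝ) : Set E :=
  {y | γ (hyperplaneProj e y) < inner ℝ e y}

theorem isOpen_epigraph (hγ : Continuous γ) : IsOpen (epigraph e γ) :=
  isOpen_lt (hγ.comp (hyperplaneProj e).continuous) (by fun_prop)

theorem mem_range_graphMap_iff (he : ‖e‖ = 1) {y : E} :
    y ∈ range (graphMap e γ) ↔ γ (hyperplaneProj e y) = inner ℝ e y := by
  constructor
  · rintro ⟨z, rfl⟩
    rw [graphMap, hyperplaneProj_add_smul he, inner_add_smul he]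
  · intro h
    refine ⟨hyperplaneProj e y, ?_⟩
    rw [graphMap, h, coe_hyperplaneProj he]
    abel

theorem graphShear_mem_epigraph_iff (he : ‖e‖ = 1) (p : hyperplane e × ℝ) :
    graphShear e γ p ∈ epigraph e γ ↔ 0 < p.2 := by
  have h : graphShear e γ p = (p.1 : E) + (γ p.1 + p.2) • e := by
    rw [graphShear, graphMap, add_smul, add_assoc]
  rw [epigraph, mem_ofPred_eq, h, hyperplaneProj_add_smul he, inner_add_smul he]
  exact lt_add_iff_pos_right _

theorem frontier_epigraph (he : ‖e‖ = 1) (hγ : Continuous γ) :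
    frontier (epigraph e γ) = range (graphMap e γ) := by
  have hP := hγ.comp (hyperplaneProj e).continuous
  refine Subset.antisymm (fun y hy => (mem_range_graphMap_iff he).2
    (frontier_lt_subset_eq hP (by fun_prop) hy)) ?_
  rintro _ ⟨z, rfl⟩
  refine ⟨?_, ?_⟩
  · have hlim : Tendsto (fun s : ℝ => graphShear e γ (z, s)) (𝓝[>] 0) (𝓝 (graphMap e γ z)) := by
      have hc : Continuous fun s : ℝ => graphShear e γ (z, s) := by
        change Continuous fun s : ℝ => graphMap e γ z + s • e
        fun_prop
      have := (hc.tendsto 0).mono_left (nhdsWithin_le_nhds (s := Ioi 0))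
      simpa [graphShear] using this
    exact mem_closure_of_tendsto hlim (eventually_nhdsWithin_of_forall fun s hs =>
      (graphShear_mem_epigraph_iff he (z, s)).2 hs)
  · rw [(isOpen_epigraph hγ).interior_eq, epigraph, mem_ofPred_eq,
      (mem_range_graphMap_iff (γ := γ) he).1 (mem_range_self z)]
    exact lt_irrefl _

variable [MeasurableSpace E] [BorelSpace E] {K : ℝ≥0} {u : E → ℝ}

theorem norm_inner_dual_sub_le (hγ : LipschitzWith K γ) (v : E) (z : hyperplane e) :
    ‖fderiv ℝ γ z (hyperplaneProj e v) - inner ℝ e v‖ ≤ K * ‖hyperplaneProj e v‖ + ‖e‖ * ‖v‖ := by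
  refine (norm_sub_le _ _).trans (add_le_add ?_ (norm_inner_le_norm e v))
  exact (ContinuousLinearMap.le_opNorm _ _).trans
    (mul_le_mul_of_nonneg_right (norm_fderiv_le_of_lipschitz ℝ hγ) (norm_nonneg _))

/-- Integration of `∂_v u` along a Lipschitz graph. The function `z ↦ u(z + γ(z) e)` is Lipschitz
with compact support, so that the integrals of its derivatives vanish. -/
theorem integral_fderiv_graphMap (he : ‖e‖ = 1) (hγ : LipschitzWith K γ) (hu : ContDiff ℝ 1 u)
    (hc : HasCompactSupport u) (v : E) :
    ∫ z, fderiv ℝ u (graphMap e γ z) v =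
      -∫ z, (fderiv ℝ γ z (hyperplaneProj e v) - inner ℝ e v) *
        fderiv ℝ u (graphMap e γ z) e := by
  have hemb := isClosedEmbedding_graphMap he hγ
  obtain ⟨C, hC⟩ := hu.lipschitzWith_of_hasCompactSupport hc one_ne_zero
  have hlip := hC.comp (hγ.graphMap he)
  have hsupp : HasCompactSupport (u ∘ graphMap e γ) := hc.comp_isClosedEmbedding hemb
  set vH := hyperplaneProj e v with hvH
  have hdec : v = (vH : E) + inner ℝ e v • e := by rw [hvH, coe_hyperplaneProj he]; abel
  have hzero : ∫ z, lineDeriv ℝ (u ∘ graphMap e γ) z vH = 0 := by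
    have h := LipschitzWith.integral_lineDeriv_mul_eq (μ := volume)
      (LipschitzWith.const (α := hyperplane e) (1 : ℝ)) hlip hsupp (-vH)
    simpa [lineDeriv] using h.symm
  have hline : ∀ᵐ z, lineDeriv ℝ (u ∘ graphMap e γ) z vH = fderiv ℝ u (graphMap e γ z) v +
      (fderiv ℝ γ z vH - inner ℝ e v) * fderiv ℝ u (graphMap e γ z) e := by
    filter_upwards [hγ.ae_differentiableAt] with z hz
    have h1 : HasFDerivAt (graphMap e γ)
        ((hyperplane e).subtypeL + (fderiv ℝ γ z).smulRight e) z :=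
      (hyperplane e).subtypeL.hasFDerivAt.add (hz.hasFDerivAt.smul_const e)
    have h2 := ((hu.differentiable one_ne_zero) (graphMap e γ z)).hasFDerivAt.comp z h1
    rw [(h2.hasLineDerivAt vH).lineDeriv]
    conv_rhs => rw [hdec]
    simp only [ContinuousLinearMap.comp_apply, add_apply, map_add,
      Submodule.subtypeL_apply, ContinuousLinearMap.smulRight_apply, map_smul, smul_eq_mul,
      inner_add_smul he]
    ring
  have hcont : ∀ w : E, Integrable fun z => fderiv ℝ u (graphMap e γ z) w := fun w => by
    refine Continuous.integrable_of_hasCompactSupport ?_ ?_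
    · exact ((hu.continuous_fderiv one_ne_zero).clm_apply continuous_const).comp hemb.continuous
    · exact (hc.fderiv_apply (𝕜 := ℝ) w).comp_isClosedEmbedding hemb
  have hint : Integrable fun z => (fderiv ℝ γ z vH - inner ℝ e v) *
      fderiv ℝ u (graphMap e γ z) e :=
    (hcont e).bdd_mul
      ((measurable_fderiv_apply_const ℝ γ vH).sub_const _).aestronglyMeasurable
      (ae_of_all _ (norm_inner_dual_sub_le hγ v))
  rw [integral_congr_ae hline, integral_add (hcont v) hint] at hzero
  linarith

theorem integrable_mul_comp_graphShear (he : ‖e‖ = 1) (hγ : LipschitzWith K γ)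
    (hu : ContDiff ℝ 1 u) (hc : HasCompactSupport u) (v w : E) :
    Integrable (fun p : hyperplane e × ℝ =>
      (fderiv ℝ γ p.1 (hyperplaneProj e v) - inner ℝ e v) * fderiv ℝ u (graphShear e γ p) w)
      (volume.prod volume) := by
  have hmp := measurePreserving_graphShear he hγ.continuous.measurable
  have hi : Integrable fun y => fderiv ℝ u y w :=
    ((hu.continuous_fderiv one_ne_zero).clm_apply continuous_const).integrable_of_hasCompactSupport
      (hc.fderiv_apply (𝕜 := ℝ) w)
  have hi' := (hmp.integrable_comp hi.aestronglyMeasurable).2 hi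
  refine hi'.bdd_mul ?_ (ae_of_all _ fun p => norm_inner_dual_sub_le hγ v p.1)
  exact (((measurable_fderiv_apply_const ℝ γ _).sub_const _).comp
    measurable_fst).aestronglyMeasurable

theorem hasDerivAt_comp_graphShear (hu : ContDiff ℝ 1 u) (z : hyperplane e) (s : ℝ) :
    HasDerivAt (fun s => u (graphShear e γ (z, s))) (fderiv ℝ u (graphShear e γ (z, s)) e) s := by
  have h1 : HasDerivAt (fun s : ℝ => graphShear e γ (z, s)) e s := by
    simpa [graphShear] using ((hasDerivAt_id s).smul_const e).const_add (graphMap e γ z)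
  exact ((hu.differentiable one_ne_zero) _).hasFDerivAt.comp_hasDerivAt s h1

theorem integral_Ioi_fderiv_graphShear (he : ‖e‖ = 1) (hu : ContDiff ℝ 1 u)
    (hc : HasCompactSupport u) (z : hyperplane e) :
    ∫ s in Ioi (0 : ℝ), fderiv ℝ u (graphShear e γ (z, s)) e = -u (graphMap e γ z) := by
  have hcd : ContDiff ℝ 1 fun s : ℝ => u (graphShear e γ (z, s)) := by
    refine hu.comp ?_
    change ContDiff ℝ 1 fun s : ℝ => graphMap e γ z + s • e
    fun_prop
  have hiso : Isometry fun s : ℝ => graphShear e γ (z, s) := by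
    refine Isometry.of_dist_eq fun s t => ?_
    simp only [graphShear, dist_add_left]
    rw [dist_eq_norm, dist_eq_norm, ← sub_smul, norm_smul, he, mul_one]
  have hcs : HasCompactSupport fun s : ℝ => u (graphShear e γ (z, s)) :=
    hc.comp_isClosedEmbedding hiso.isClosedEmbedding
  have h := hcs.integral_Ioi_deriv_eq hcd 0
  simp only [(hasDerivAt_comp_graphShear hu z _).deriv] at h
  rw [h]
  simp [graphShear]

theorem setIntegral_epigraph (he : ‖e‖ = 1) (hγ : LipschitzWith K γ) {f : E → ℝ}
    (hf : Integrable f) :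
    ∫ y in epigraph e γ, f y =
      ∫ p : hyperplane e × ℝ, f (graphShear e γ p) ∂(volume.prod (volume.restrict (Ioi 0))) := by
  have hmp := measurePreserving_graphShear he hγ.continuous.measurable
  have hU := (isOpen_epigraph (e := e) hγ.continuous).measurableSet
  have hpre : graphShear e γ ⁻¹' epigraph e γ = univ ×ˢ Ioi (0 : ℝ) := by
    ext p
    simp [graphShear_mem_epigraph_iff he p]
  have hr := hmp.restrict_preimage hU
  rw [hpre, ← Measure.prod_restrict, Measure.restrict_univ] at hr
  rw [← hr.map_eq, integral_map hr.measurable.aemeasurable]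
  rw [hr.map_eq]
  exact hf.aestronglyMeasurable.restrict

/-- The divergence theorem for the epigraph of a Lipschitz function. The weight is
`⟨∇γ - e, v⟩ = √(1 + |∇γ|²) ⟨n, v⟩`. -/
theorem setIntegral_epigraph_fderiv (he : ‖e‖ = 1) (hγ : LipschitzWith K γ) (hu : ContDiff ℝ 1 u)
    (hc : HasCompactSupport u) (v : E) :
    ∫ y in epigraph e γ, fderiv ℝ u y v =
      ∫ z, (fderiv ℝ γ z (hyperplaneProj e v) - inner ℝ e v) * u (graphMap e γ z) := by
  have hi : Integrable fun y => fderiv ℝ u y v :=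
    ((hu.continuous_fderiv one_ne_zero).clm_apply continuous_const).integrable_of_hasCompactSupport
      (hc.fderiv_apply (𝕜 := ℝ) v)
  have hmp := measurePreserving_graphShear he hγ.continuous.measurable
  have hle : (volume : Measure (hyperplane e)).prod (volume.restrict (Ioi (0 : ℝ))) ≤
      volume.prod volume := by
    rw [← Measure.restrict_univ (μ := (volume : Measure (hyperplane e))), Measure.prod_restrict,
      Measure.restrict_univ]
    exact Measure.restrict_le_self
  have hi' : Integrable (fun p => fderiv ℝ u (graphShear e γ p) v)
      ((volume : Measure (hyperplane e)).prod (volume.restrict (Ioi (0 : ℝ)))) :=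
    ((hmp.integrable_comp hi.aestronglyMeasurable).2 hi).mono_measure hle
  have hi2 := (integrable_mul_comp_graphShear he hγ hu hc v e).mono_measure hle
  -- on the translate of the graph by `s e`, the hypersurface identity applies to `γ + s`
  have hslice : ∀ s : ℝ, ∫ z, fderiv ℝ u (graphShear e γ (z, s)) v =
      -∫ z, (fderiv ℝ γ z (hyperplaneProj e v) - inner ℝ e v) *
        fderiv ℝ u (graphShear e γ (z, s)) e := fun s => by
    have h := integral_fderiv_graphMap he (γ := fun z => γ z + s) (K := K + 0)
      (hγ.add (LipschitzWith.const s)) hu hc v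
    have h1 : ∀ z, graphMap e (fun z => γ z + s) z = graphShear e γ (z, s) := fun z => by
      simp only [graphMap, graphShear, add_smul, add_assoc]
    simpa only [h1, fderiv_add_const] using h
  rw [setIntegral_epigraph he hγ hi, integral_prod_symm _ hi']
  simp only [hslice]
  rw [integral_neg, ← integral_prod_symm _ hi2, integral_prod _ hi2, ← integral_neg]
  refine integral_congr_ae (ae_of_all _ fun z => ?_)
  simp only
  rw [integral_const_mul, integral_Ioi_fderiv_graphShear he hu hc]
  ring

/-- The trace inequality over an epigraph: the value of `u` on the graph is the integral of its
derivative along the vertical half-line above. -/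
theorem lintegral_enorm_graphMap_le (he : ‖e‖ = 1) (hγ : LipschitzWith K γ) (hu : ContDiff ℝ 1 u)
    (hc : HasCompactSupport u) :
    ∫⁻ z, ‖u (graphMap e γ z)‖ₑ ≤ ∫⁻ y in epigraph e γ, ‖fderiv ℝ u y‖ₑ := by
  have hmp := measurePreserving_graphShear he hγ.continuous.measurable
  have hU := (isOpen_epigraph (e := e) hγ.continuous).measurableSet
  have hpre : graphShear e γ ⁻¹' epigraph e γ = univ ×ˢ Ioi (0 : ℝ) := by
    ext p
    simp [graphShear_mem_epigraph_iff he p]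
  have hr := hmp.restrict_preimage hU
  rw [hpre, ← Measure.prod_restrict, Measure.restrict_univ] at hr
  have hm : Measurable fun y => ‖fderiv ℝ u y‖ₑ :=
    (hu.continuous_fderiv one_ne_zero).enorm.measurable
  have hm' : Measurable fun p => ‖fderiv ℝ u (graphShear e γ p)‖ₑ := hm.comp hr.measurable
  rw [← hr.lintegral_comp hm, lintegral_prod _ hm'.aemeasurable]
  refine lintegral_mono fun z => ?_
  have h1 : ‖u (graphMap e γ z)‖ₑ =
      ‖∫ s in Ioi (0 : ℝ), fderiv ℝ u (graphShear e γ (z, s)) e‖ₑ := by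
    rw [integral_Ioi_fderiv_graphShear he hu hc, enorm_neg]
  rw [h1]
  refine (enorm_integral_le_lintegral_enorm _).trans (lintegral_mono fun s => ?_)
  rw [← ofReal_norm, ← ofReal_norm]
  refine ENNReal.ofReal_le_ofReal ?_
  simpa [he] using (fderiv ℝ u (graphShear e γ (z, s))).le_opNorm e

end GraphIntegrals

/-! ### Lipschitz charts of the boundary -/

section Chart

variable {d : ℕ} {Ω : Set (Euc d)} {x e : Euc d} {r : ℝ} {γ : Euc d → ℝ} {K : ℝ≥0}

theorem IsLocalEpigraph.inter_ball (hΩ : IsLocalEpigraph Ω x e r γ) :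
    Ω ∩ Metric.ball x r = epigraph e (fun z => γ z) ∩ Metric.ball x r := by
  ext y
  simp only [mem_inter_iff, and_congr_left_iff]
  intro hy
  rw [hΩ.2.2 y hy, epigraph, mem_ofPred_eq, coe_hyperplaneProj hΩ.1]

theorem LipschitzWith.restrict_hyperplane (hγ : LipschitzWith K γ) (e : Euc d) :
    LipschitzWith K fun z : hyperplane e => γ z := by
  exact LipschitzWith.of_dist_le_mul fun z w => hγ.dist_le_mul z w

theorem IsLocalEpigraph.frontier_inter_ball (hΩ : IsLocalEpigraph Ω x e r γ)
    (hγ : LipschitzWith K γ) :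
    frontier Ω ∩ Metric.ball x r = range (graphMap e fun z => γ z) ∩ Metric.ball x r := by
  rw [← frontier_epigraph hΩ.1 (hγ.restrict_hyperplane e).continuous,
    ← frontier_inter_open_inter (s := Ω) Metric.isOpen_ball, hΩ.inter_ball,
    frontier_inter_open_inter Metric.isOpen_ball]

theorem IsLocalEpigraph.surfaceMeasure_restrict_ball (hΩ : IsLocalEpigraph Ω x e r γ)
    (hγ : LipschitzWith K γ) :
    (surfaceMeasure Ω).restrict (Metric.ball x r) =
      ((volume.withDensity fun z =>
        ENNReal.ofReal (graphDensity (fun z : hyperplane e => γ z) z)).map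
          (graphMap e fun z => γ z)).restrict (Metric.ball x r) := by
  have hfin : Module.finrank ℝ (hyperplane e) = d - 1 := by
    rw [finrank_hyperplane hΩ.1, finrank_euclideanSpace, Fintype.card_fin]
  rw [← euclideanHausdorffMeasure_restrict_range_graphMap hΩ.1 (hγ.restrict_hyperplane e),
    surfaceMeasure, Measure.restrict_restrict Metric.isOpen_ball.measurableSet,
    Measure.restrict_restrict Metric.isOpen_ball.measurableSet, inter_comm,
    hΩ.frontier_inter_ball hγ, inter_comm, hfin]

theorem IsLocalEpigraph.ae_outwardNormal (hΩ : IsLocalEpigraph Ω x e r γ)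
    (hγ : LipschitzWith K γ) :
    ∀ᵐ z : hyperplane e, graphMap e (fun z => γ z) z ∈ Metric.ball x r →
      outwardNormal Ω (graphMap e (fun z => γ z) z) =
        (graphDensity (fun z : hyperplane e => γ z) z)⁻¹ •
          graphGradient (fun z : hyperplane e => γ z) z := by
  filter_upwards [(hγ.restrict_hyperplane e).ae_differentiableAt] with z hz hzx
  exact outwardNormal_graphMap hΩ hz hzx

theorem IsLocalEpigraph.aestronglyMeasurable_inner_outwardNormal
    (hΩ : IsLocalEpigraph Ω x e r γ) (hγ : LipschitzWith K γ) (v : Euc d) :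
    AEStronglyMeasurable (fun y => inner ℝ (outwardNormal Ω y) v)
      ((surfaceMeasure Ω).restrict (Metric.ball x r)) := by
  have hemb := (isClosedEmbedding_graphMap hΩ.1 (hγ.restrict_hyperplane e)).measurableEmbedding
  rw [hΩ.surfaceMeasure_restrict_ball hγ, hemb.restrict_map, hemb.aestronglyMeasurable_map_iff]
  refine AEStronglyMeasurable.congr (f := fun z =>
    (graphDensity (fun z : hyperplane e => γ z) z)⁻¹ *
      inner ℝ (graphGradient (fun z : hyperplane e => γ z) z) v) ?_ ?_
  · exact ((measurable_graphDensity _).inv.mul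
      (measurable_inner_graphGradient _ v)).aestronglyMeasurable
  · rw [EventuallyEq, ae_restrict_iff' (hemb.measurable Metric.isOpen_ball.measurableSet)]
    filter_upwards [(withDensity_absolutelyContinuous volume _).ae_le (hΩ.ae_outwardNormal hγ)]
      with z hz hzx
    rw [Function.comp_apply, hz hzx, inner_smul_left]
    rfl

variable {u : Euc d → ℝ}

theorem enorm_zero_clm : ‖(0 : Euc d →L[ℝ] ℝ)‖ₑ = 0 := by
  rw [← ofReal_norm, norm_zero, ENNReal.ofReal_zero]

theorem setIntegral_eq_of_inter_eq {α : Type*} [MeasurableSpace α] {μ : Measure α} {s t B : Set α}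
    (hs : MeasurableSet s) (ht : MeasurableSet t) (h : s ∩ B = t ∩ B) {f : α → ℝ}
    (hf : ∀ y, y ∉ B → f y = 0) : ∫ y in s, f y ∂μ = ∫ y in t, f y ∂μ := by
  rw [← integral_indicator hs, ← integral_indicator ht]
  congr 1
  funext y
  by_cases hy : y ∈ B
  · have : y ∈ s ↔ y ∈ t := by
      have := Set.ext_iff.1 h y
      simpa [hy] using this
    by_cases hys : y ∈ s
    · rw [indicator_of_mem hys, indicator_of_mem (this.1 hys)]
    · rw [indicator_of_notMem hys, indicator_of_notMem (fun h => hys (this.2 h))]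
  · simp only [indicator, hf y hy, ite_self]

/-- The divergence theorem for functions supported in a ball in which `Ω` is a Lipschitz
epigraph. -/
theorem IsLocalEpigraph.setIntegral_fderiv (hΩo : IsOpen Ω) (hΩ : IsLocalEpigraph Ω x e r γ)
    (hγ : LipschitzWith K γ) (hu : ContDiff ℝ 1 u) (hc : HasCompactSupport u)
    (hs : tsupport u ⊆ Metric.ball x r) (v : Euc d) :
    ∫ y in Ω, fderiv ℝ u y v = ∫ y, u y * inner ℝ (outwardNormal Ω y) v ∂(surfaceMeasure Ω) := by
  have hγ' := hγ.restrict_hyperplane e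
  have hemb := (isClosedEmbedding_graphMap hΩ.1 hγ').measurableEmbedding
  have hu0 : ∀ y, y ∉ Metric.ball x r → u y = 0 := fun y hy =>
    image_eq_zero_of_notMem_tsupport fun h => hy (hs h)
  have hd0 : ∀ y, y ∉ Metric.ball x r → fderiv ℝ u y v = 0 := fun y hy => by
    rw [fderiv_of_notMem_tsupport ℝ fun h => hy (hs h)]
    rfl
  rw [setIntegral_eq_of_inter_eq hΩo.measurableSet (isOpen_epigraph hγ'.continuous).measurableSet
    hΩ.inter_ball hd0, setIntegral_epigraph_fderiv hΩ.1 hγ' hu hc,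
    ← setIntegral_eq_integral_of_forall_compl_eq_zero (s := Metric.ball x r)
      (μ := surfaceMeasure Ω) (fun y hy => by rw [hu0 y hy, zero_mul]),
    hΩ.surfaceMeasure_restrict_ball hγ,
    setIntegral_eq_integral_of_forall_compl_eq_zero (fun y hy => by rw [hu0 y hy, zero_mul]),
    hemb.integral_map, integral_withDensity_eq_integral_toReal_smul
      (measurable_graphDensity _).ennreal_ofReal (ae_of_all _ fun _ => ENNReal.ofReal_lt_top)]
  refine integral_congr_ae ?_
  filter_upwards [hΩ.ae_outwardNormal hγ] with z hz
  have hpos := graphDensity_pos (fun z : hyperplane e => γ z) z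
  by_cases hzx : graphMap e (fun z => γ z) z ∈ Metric.ball x r
  · rw [hz hzx, inner_smul_left, inner_graphGradient, ENNReal.toReal_ofReal hpos.le, smul_eq_mul,
      conj_trivial]
    field_simp
  · rw [hu0 _ hzx]
    simp

/-- The trace inequality for functions supported in a ball in which `Ω` is a Lipschitz
epigraph. -/
theorem IsLocalEpigraph.lintegral_surfaceMeasure_le
    (hΩ : IsLocalEpigraph Ω x e r γ)
    (hγ : LipschitzWith K γ) (hu : ContDiff ℝ 1 u) (hc : HasCompactSupport u)
    (hs : tsupport u ⊆ Metric.ball x r) :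
    ∫⁻ y, ‖u y‖ₑ ∂(surfaceMeasure Ω) ≤
      ((1 + K : ℝ≥0) : ℝ≥0∞) * ∫⁻ y in Ω, ‖fderiv ℝ u y‖ₑ := by
  have hγ' := hγ.restrict_hyperplane e
  have hemb := (isClosedEmbedding_graphMap hΩ.1 hγ').measurableEmbedding
  have hB := (Metric.isOpen_ball (x := x) (ε := r)).measurableSet
  have hU := (isOpen_epigraph hγ'.continuous).measurableSet
  have hu0 : ∀ μ : Measure (Euc d), ∫⁻ y, ‖u y‖ₑ ∂μ = ∫⁻ y in Metric.ball x r, ‖u y‖ₑ ∂μ :=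
    fun μ => (setLIntegral_eq_of_support_subset fun y hy => hs (subset_tsupport u fun h =>
      hy (by simp [h]))).symm
  have hd0 : ∀ μ : Measure (Euc d),
      ∫⁻ y, ‖fderiv ℝ u y‖ₑ ∂μ = ∫⁻ y in Metric.ball x r, ‖fderiv ℝ u y‖ₑ ∂μ :=
    fun μ => (setLIntegral_eq_of_support_subset fun y hy => hs (by
      by_contra h
      exact hy (by simp only [fderiv_of_notMem_tsupport ℝ h, enorm_zero_clm]))).symm
  have hc1 : ((1 + K : ℝ≥0) : ℝ≥0∞) = ENNReal.ofReal (1 + K) := by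
    rw [← ENNReal.ofReal_coe_nnreal]; push_cast; rfl
  have hum : Measurable fun z : hyperplane e => ‖u (graphMap e (fun z => γ z) z)‖ₑ :=
    hu.continuous.enorm.measurable.comp hemb.measurable
  rw [hu0, hΩ.surfaceMeasure_restrict_ball hγ, ← hu0, hemb.lintegral_map,
    lintegral_withDensity_eq_lintegral_mul _ (measurable_graphDensity _).ennreal_ofReal hum]
  calc ∫⁻ z, ENNReal.ofReal (graphDensity (fun z : hyperplane e => γ z) z) *
          ‖u (graphMap e (fun z => γ z) z)‖ₑ
      ≤ ∫⁻ z, ((1 + K : ℝ≥0) : ℝ≥0∞) * ‖u (graphMap e (fun z => γ z) z)‖ₑ := by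
        refine lintegral_mono fun z => ?_
        rw [hc1]
        gcongr
        exact graphDensity_le hγ' z
    _ = ((1 + K : ℝ≥0) : ℝ≥0∞) * ∫⁻ z, ‖u (graphMap e (fun z => γ z) z)‖ₑ :=
        lintegral_const_mul' _ _ ENNReal.coe_ne_top
    _ ≤ ((1 + K : ℝ≥0) : ℝ≥0∞) * ∫⁻ y in epigraph e (fun z => γ z), ‖fderiv ℝ u y‖ₑ := by
        gcongr
        exact lintegral_enorm_graphMap_le hΩ.1 hγ' hu hc
    _ = ((1 + K : ℝ≥0) : ℝ≥0∞) * ∫⁻ y in Ω, ‖fderiv ℝ u y‖ₑ := by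
        rw [hd0, hd0 (volume.restrict Ω), Measure.restrict_restrict hB,
          Measure.restrict_restrict hB, inter_comm, ← hΩ.inter_ball, inter_comm]

end Chart

/-! ### The divergence theorem and the trace inequality -/

section Global

variable {d : ℕ} {Ω : Set (Euc d)}

theorem exists_smooth_partition_of_unity {s : Set (Euc d)} (hs : IsCompact s) {r : Euc d → ℝ}
    (hr : ∀ x ∈ s, 0 < r x) :
    ∃ (t : Finset (Euc d)) (ζ : Euc d → Euc d → ℝ), (∀ i ∈ t, i ∈ s) ∧
      (∀ i ∈ t, ContDiff ℝ ∞ (ζ i) ∧ HasCompactSupport (ζ i) ∧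
        tsupport (ζ i) ⊆ Metric.ball i (r i)) ∧
      ∀ y ∈ s, ∑ i ∈ t, ζ i y = 1 := by
  classical
  obtain ⟨t, hts, hcov⟩ := hs.elim_nhds_subcover (fun x => Metric.ball x (r x))
    fun x hx => Metric.ball_mem_nhds x (hr x hx)
  have hcov' : s ⊆ ⋃ i : t, Metric.ball (i : Euc d) (r i) := by
    intro y hy
    obtain ⟨i, hi, hyi⟩ := mem_iUnion₂.1 (hcov hy)
    exact mem_iUnion.2 ⟨⟨i, hi⟩, hyi⟩
  obtain ⟨f, hf⟩ := SmoothPartitionOfUnity.exists_isSubordinate (modelWithCornersSelf ℝ (Euc d))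
    hs.isClosed _ (fun i : t => Metric.isOpen_ball) hcov'
  refine ⟨t, fun i => if h : i ∈ t then f ⟨i, h⟩ else 0, hts, fun i hi => ?_, fun y hy => ?_⟩
  · simp only [dif_pos hi]
    refine ⟨(f ⟨i, hi⟩).contMDiff.contDiff, ?_, hf ⟨i, hi⟩⟩
    exact Metric.isCompact_of_isClosed_isBounded (isClosed_tsupport _)
      (Metric.isBounded_ball.subset (hf ⟨i, hi⟩))
  · have h := f.sum_eq_one hy
    rw [finsum_eq_sum_of_fintype] at h
    rw [← h, ← Finset.sum_coe_sort t]
    refine Finset.sum_congr rfl fun i _ => ?_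
    simp

theorem integral_fderiv_eq_zero {u : Euc d → ℝ} (hu : ContDiff ℝ 1 u) (hc : HasCompactSupport u)
    (v : Euc d) : ∫ y, fderiv ℝ u y v = 0 := by
  obtain ⟨C, hC⟩ := hu.lipschitzWith_of_hasCompactSupport hc one_ne_zero
  have h := LipschitzWith.integral_lineDeriv_mul_eq (μ := volume)
      (LipschitzWith.const (α := Euc d) (1 : ℝ)) hC hc (-v)
  have h1 : ∀ y, lineDeriv ℝ u y v = fderiv ℝ u y v := fun y =>
    ((hu.differentiable one_ne_zero) y).lineDeriv_eq_fderiv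
  have h2 : ∫ y, lineDeriv ℝ u y v = 0 := by simpa [lineDeriv] using h.symm
  simpa only [h1] using h2

/-- Near every point of the closure of a Lipschitz set, the divergence theorem and the trace
inequality hold for functions with small support. -/
theorem IsLipschitzSet.exists_local (hΩo : IsOpen Ω) (hΩ : IsLipschitzSet Ω) {x : Euc d}
    (hx : x ∈ closure Ω) :
    ∃ r > 0, ∃ C : ℝ≥0,
      (∀ v, AEStronglyMeasurable (fun y => inner ℝ (outwardNormal Ω y) v)
        ((surfaceMeasure Ω).restrict (Metric.ball x r))) ∧
      ∀ u : Euc d → ℝ, ContDiff ℝ 1 u → HasCompactSupport u → tsupport u ⊆ Metric.ball x r →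
        (∀ v, ∫ y in Ω, fderiv ℝ u y v =
          ∫ y, u y * inner ℝ (outwardNormal Ω y) v ∂(surfaceMeasure Ω)) ∧
        ∫⁻ y, ‖u y‖ₑ ∂(surfaceMeasure Ω) ≤ C * ∫⁻ y in Ω, ‖fderiv ℝ u y‖ₑ := by
  by_cases hxΩ : x ∈ Ω
  · obtain ⟨r, hr, hball⟩ := Metric.isOpen_iff.1 hΩo x hxΩ
    have hdis : Metric.ball x r ∩ frontier Ω = ∅ := by
      rw [hΩo.frontier_eq]
      ext y
      simp only [mem_inter_iff, Set.mem_sdiff, mem_empty_iff_false, iff_false]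
      exact fun h => h.2.2 (hball h.1)
    have hSr : (surfaceMeasure Ω).restrict (Metric.ball x r) = 0 := by
      rw [surfaceMeasure, Measure.restrict_restrict Metric.isOpen_ball.measurableSet, hdis,
        Measure.restrict_empty]
    refine ⟨r, hr, 0, fun v => by rw [hSr]; exact aestronglyMeasurable_zero_measure _,
      fun u hu hc hs => ⟨fun v => ?_, ?_⟩⟩
    · rw [setIntegral_eq_integral_of_forall_compl_eq_zero, integral_fderiv_eq_zero hu hc,
        ← setIntegral_eq_integral_of_forall_compl_eq_zero (s := Metric.ball x r)
          (μ := surfaceMeasure Ω), hSr, integral_zero_measure]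
      · intro y hy
        rw [image_eq_zero_of_notMem_tsupport fun h => hy (hs h), zero_mul]
      · intro y hy
        rw [fderiv_of_notMem_tsupport ℝ fun h => hy (hball (hs h))]
        rfl
    · rw [← setLIntegral_eq_of_support_subset (s := Metric.ball x r) fun y hy =>
        hs (subset_tsupport u fun h => hy (by simp [h])), hSr]
      simp
  · have hxf : x ∈ frontier Ω := by
      rw [hΩo.frontier_eq]; exact ⟨hx, hxΩ⟩
    obtain ⟨e, r, γ, hepi, K, hγ⟩ := hΩ x hxf
    exact ⟨r, hepi.2.1, 1 + K, hepi.aestronglyMeasurable_inner_outwardNormal hγ,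
      fun u hu hc hs => ⟨hepi.setIntegral_fderiv hΩo hγ hu hc hs,
        hepi.lintegral_surfaceMeasure_le hγ hu hc hs⟩⟩

/-- A smooth partition of unity on the closure of a bounded Lipschitz set, fine enough for the
local divergence theorem and trace inequality. -/
theorem IsLipschitzSet.exists_partition (hΩo : IsOpen Ω) (hΩb : Bornology.IsBounded Ω)
    (hΩ : IsLipschitzSet Ω) :
    ∃ (t : Finset (Euc d)) (ζ : Euc d → Euc d → ℝ) (C : ℝ≥0),
      (∀ y ∈ closure Ω, ∑ i ∈ t, ζ i y = 1) ∧
      (∀ v, AEStronglyMeasurable (fun y => inner ℝ (outwardNormal Ω y) v) (surfaceMeasure Ω)) ∧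
      ∀ i ∈ t, ContDiff ℝ ∞ (ζ i) ∧ HasCompactSupport (ζ i) ∧
        ∀ u : Euc d → ℝ, ContDiff ℝ 1 u →
          (∀ v, ∫ y in Ω, fderiv ℝ (fun y => ζ i y * u y) y v =
            ∫ y, ζ i y * u y * inner ℝ (outwardNormal Ω y) v ∂(surfaceMeasure Ω)) ∧
          ∫⁻ y, ‖ζ i y * u y‖ₑ ∂(surfaceMeasure Ω) ≤
            C * ∫⁻ y in Ω, ‖fderiv ℝ (fun y => ζ i y * u y) y‖ₑ := by
  classical
  have hloc := fun (x : Euc d) (hx : x ∈ closure Ω) => hΩ.exists_local hΩo hx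
  choose! r hr C hmeas H using hloc
  obtain ⟨t, ζ, hts, hζ, hsum⟩ := exists_smooth_partition_of_unity hΩb.isCompact_closure hr
  refine ⟨t, ζ, ∑ i ∈ t, C i, hsum, fun v => ?_, fun i hi => ⟨(hζ i hi).1, (hζ i hi).2.1, ?_⟩⟩
  · -- the balls of the cover exhaust the surface measure
    have hcov : ∀ y ∈ frontier Ω, y ∈ ⋃ i : t, Metric.ball (i : Euc d) (r i) := fun y hy => by
      by_contra hn
      have h0 : ∑ i ∈ t, ζ i y = 0 := Finset.sum_eq_zero fun i hi =>
        image_eq_zero_of_notMem_tsupport fun h =>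
          hn (mem_iUnion.2 ⟨⟨i, hi⟩, (hζ i hi).2.2 h⟩)
      rw [hsum y (frontier_subset_closure hy)] at h0
      exact one_ne_zero h0
    have hrest : (surfaceMeasure Ω).restrict (⋃ i : t, Metric.ball (i : Euc d) (r i)) =
        surfaceMeasure Ω := by
      refine Measure.restrict_eq_self_of_ae_mem ?_
      rw [surfaceMeasure]
      filter_upwards [ae_restrict_mem isClosed_frontier.measurableSet] with y hy
      exact hcov y hy
    rw [← hrest, aestronglyMeasurable_iUnion_iff]
    exact fun i => hmeas i (hts i i.2) v
  · intro u hu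
    have hsupp : tsupport (fun y => ζ i y * u y) ⊆ tsupport (ζ i) := tsupport_mul_subset_left
    have h := H i (hts i hi) (fun y => ζ i y * u y)
      (((hζ i hi).1.of_le (by exact_mod_cast le_top)).mul hu) (hζ i hi).2.1.mul_right
      (hsupp.trans (hζ i hi).2.2)
    refine ⟨h.1, h.2.trans ?_⟩
    gcongr
    exact Finset.single_le_sum (f := C) (fun _ _ => zero_le) hi

theorem enorm_fderiv_mul_le {f g : Euc d → ℝ} {y : Euc d} (hf : DifferentiableAt ℝ f y)
    (hg : DifferentiableAt ℝ g y) :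
    ‖fderiv ℝ (fun y => f y * g y) y‖ₑ ≤ ‖f y‖ₑ * ‖fderiv ℝ g y‖ₑ + ‖fderiv ℝ f y‖ₑ * ‖g y‖ₑ := by
  rw [fderiv_fun_mul hf hg]
  simp only [← ofReal_norm]
  rw [← ENNReal.ofReal_mul (norm_nonneg _), ← ENNReal.ofReal_mul (norm_nonneg _),
    ← ENNReal.ofReal_add (by positivity) (by positivity)]
  refine ENNReal.ofReal_le_ofReal ((norm_add_le _ _).trans_eq ?_)
  rw [norm_smul, norm_smul, mul_comm ‖g y‖]

/-- **Trace inequality** for functions of class `C¹` up to the boundary. -/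
theorem IsLipschitzSet.exists_lintegral_surfaceMeasure_le (hΩo : IsOpen Ω)
    (hΩb : Bornology.IsBounded Ω) (hΩ : IsLipschitzSet Ω) :
    ∃ C : ℝ≥0, ∀ u : Euc d → ℝ, ContDiff ℝ 1 u →
      ∫⁻ y, ‖u y‖ₑ ∂(surfaceMeasure Ω) ≤
        C * ((∫⁻ y in Ω, ‖u y‖ₑ) + ∫⁻ y in Ω, ‖fderiv ℝ u y‖ₑ) := by
  obtain ⟨t, ζ, C, hsum, -, hζ⟩ := hΩ.exists_partition hΩo hΩb
  have hbound : ∀ i ∈ t, ∃ M : ℝ≥0, ∀ y, ‖ζ i y‖ₑ ≤ M ∧ ‖fderiv ℝ (ζ i) y‖ₑ ≤ M := by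
    intro i hi
    obtain ⟨h1, h2, -⟩ := hζ i hi
    obtain ⟨M₁, hM₁⟩ := h2.exists_bound_of_continuous h1.continuous
    obtain ⟨M₂, hM₂⟩ := (h2.fderiv (𝕜 := ℝ)).exists_bound_of_continuous
      (h1.continuous_fderiv (by simp))
    refine ⟨(max M₁ M₂).toNNReal, fun y => ⟨?_, ?_⟩⟩ <;>
      rw [← ofReal_norm, ← ENNReal.ofReal] <;> refine ENNReal.ofReal_le_ofReal ?_
    · exact (hM₁ y).trans (le_max_left _ _)
    · exact (hM₂ y).trans (le_max_right _ _)
  choose! M hM using hbound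
  refine ⟨∑ i ∈ t, C * M i, fun u hu => ?_⟩
  have hum : Measurable fun y => ‖u y‖ₑ := hu.continuous.enorm.measurable
  have hpt : ∀ᵐ y ∂(surfaceMeasure Ω), ‖u y‖ₑ ≤ ∑ i ∈ t, ‖ζ i y * u y‖ₑ := by
    rw [surfaceMeasure]
    filter_upwards [ae_restrict_mem isClosed_frontier.measurableSet] with y hy
    have : u y = ∑ i ∈ t, ζ i y * u y := by
      rw [← Finset.sum_mul, hsum y (frontier_subset_closure hy), one_mul]
    exact (congrArg enorm this).trans_le (enorm_sum_le (ε := ℝ) t fun i => ζ i y * u y)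
  calc ∫⁻ y, ‖u y‖ₑ ∂(surfaceMeasure Ω)
      ≤ ∫⁻ y, ∑ i ∈ t, ‖ζ i y * u y‖ₑ ∂(surfaceMeasure Ω) := lintegral_mono_ae hpt
    _ = ∑ i ∈ t, ∫⁻ y, ‖ζ i y * u y‖ₑ ∂(surfaceMeasure Ω) :=
        lintegral_finsetSum' _ fun i hi =>
          ((hζ i hi).1.continuous.mul hu.continuous).enorm.measurable.aemeasurable
    _ ≤ ∑ i ∈ t, (C * M i : ℝ≥0) * ((∫⁻ y in Ω, ‖u y‖ₑ) + ∫⁻ y in Ω, ‖fderiv ℝ u y‖ₑ) := by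
        refine Finset.sum_le_sum fun i hi => (((hζ i hi).2.2 u hu).2).trans ?_
        rw [ENNReal.coe_mul, mul_assoc, ← lintegral_add_left hum]
        refine mul_le_mul_right ?_ _
        rw [← lintegral_const_mul' _ _ ENNReal.coe_ne_top]
        refine lintegral_mono fun y => ?_
        refine (enorm_fderiv_mul_le ((hζ i hi).1.differentiable (by simp) y)
          (hu.differentiable one_ne_zero y)).trans ?_
        rw [mul_add, add_comm]
        gcongr
        · exact (hM i hi y).2
        · exact (hM i hi y).1
    _ = _ := by rw [← Finset.sum_mul, ENNReal.ofNNReal_finsetSum]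

theorem IsLipschitzSet.isFiniteMeasure_surfaceMeasure (hΩo : IsOpen Ω)
    (hΩb : Bornology.IsBounded Ω) (hΩ : IsLipschitzSet Ω) :
    IsFiniteMeasure (surfaceMeasure Ω) := by
  obtain ⟨C, hC⟩ := hΩ.exists_lintegral_surfaceMeasure_le hΩo hΩb
  have h := hC (fun _ => 1) contDiff_const
  refine ⟨?_⟩
  simp only [enorm_one, lintegral_const, one_mul, fderiv_fun_const, Pi.zero_apply, enorm_zero_clm,
    zero_mul, add_zero, Measure.restrict_apply_univ] at h
  exact h.trans_lt (ENNReal.mul_lt_top ENNReal.coe_lt_top hΩb.measure_lt_top)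

/-- The boundary of a bounded Lipschitz set is negligible, since its `(d-1)`-dimensional measure is
finite. -/
theorem IsLipschitzSet.volume_frontier (hd : 0 < d) (hΩo : IsOpen Ω)
    (hΩb : Bornology.IsBounded Ω) (hΩ : IsLipschitzSet Ω) : volume (frontier Ω) = 0 := by
  have := hΩ.isFiniteMeasure_surfaceMeasure hΩo hΩb
  have h1 : (μHE[d - 1] : Measure (Euc d)) (frontier Ω) ≠ ⊤ := by
    have := measure_ne_top (surfaceMeasure Ω) univ
    rwa [surfaceMeasure, Measure.restrict_apply_univ] at this
  rw [← EuclideanSpace.euclideanHausdorffMeasure_eq_volume]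
  exact (Measure.euclideanHausdorffMeasure_zero_or_top (Nat.sub_lt hd one_pos) _).resolve_right h1

theorem integrable_surfaceMeasure_of_continuous [IsFiniteMeasure (surfaceMeasure Ω)]
    (hΩb : Bornology.IsBounded Ω) {f : Euc d → ℝ} (hf : Continuous f) :
    Integrable f (surfaceMeasure Ω) := by
  have hcomp : IsCompact (frontier Ω) :=
    hΩb.isCompact_closure.of_isClosed_subset isClosed_frontier frontier_subset_closure
  obtain ⟨M, hM⟩ := hcomp.exists_bound_of_continuousOn hf.continuousOn
  refine Integrable.of_bound hf.aestronglyMeasurable M ?_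
  rw [surfaceMeasure]
  filter_upwards [ae_restrict_mem isClosed_frontier.measurableSet] with y hy using hM y hy

theorem integrableOn_of_continuous (hΩb : Bornology.IsBounded Ω) {f : Euc d → ℝ}
    (hf : Continuous f) : IntegrableOn f Ω :=
  (hf.continuousOn.integrableOn_compact hΩb.isCompact_closure).mono_set subset_closure

theorem IsLipschitzSet.aestronglyMeasurable_inner_outwardNormal (hΩo : IsOpen Ω)
    (hΩb : Bornology.IsBounded Ω) (hΩ : IsLipschitzSet Ω) (v : Euc d) :
    AEStronglyMeasurable (fun y => inner ℝ (outwardNormal Ω y) v) (surfaceMeasure Ω) := by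
  obtain ⟨t, ζ, C, -, h, -⟩ := hΩ.exists_partition hΩo hΩb
  exact h v

theorem norm_inner_outwardNormal_le (Ω : Set (Euc d)) (y v : Euc d) :
    ‖inner ℝ (outwardNormal Ω y) v‖ ≤ ‖v‖ :=
  (norm_inner_le_norm _ _).trans (mul_le_of_le_one_left (norm_nonneg v) (norm_outwardNormal_le Ω y))

/-- **Divergence theorem** on a bounded Lipschitz set. -/
theorem IsLipschitzSet.setIntegral_fderiv (hΩo : IsOpen Ω) (hΩb : Bornology.IsBounded Ω)
    (hΩ : IsLipschitzSet Ω) {u : Euc d → ℝ} (hu : ContDiff ℝ 1 u) (v : Euc d) :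
    ∫ y in Ω, fderiv ℝ u y v = ∫ y, u y * inner ℝ (outwardNormal Ω y) v ∂(surfaceMeasure Ω) := by
  have := hΩ.isFiniteMeasure_surfaceMeasure hΩo hΩb
  obtain ⟨t, ζ, C, hsum, hmeas, hζ⟩ := hΩ.exists_partition hΩo hΩb
  have hcd : ∀ i ∈ t, ContDiff ℝ 1 fun y => ζ i y * u y := fun i hi =>
    ((hζ i hi).1.of_le (by exact_mod_cast le_top)).mul hu
  have hl : ∀ y ∈ Ω, fderiv ℝ u y v = ∑ i ∈ t, fderiv ℝ (fun y => ζ i y * u y) y v := by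
    intro y hy
    have heq : u =ᶠ[𝓝 y] fun y => ∑ i ∈ t, ζ i y * u y := by
      filter_upwards [hΩo.mem_nhds hy] with w hw
      rw [← Finset.sum_mul, hsum w (subset_closure hw), one_mul]
    rw [heq.fderiv_eq, fderiv_fun_sum fun i hi => (hcd i hi).differentiable one_ne_zero y,
      sum_apply]
  have hr : ∀ᵐ y ∂(surfaceMeasure Ω), u y * inner ℝ (outwardNormal Ω y) v =
      ∑ i ∈ t, ζ i y * u y * inner ℝ (outwardNormal Ω y) v := by
    rw [surfaceMeasure]
    filter_upwards [ae_restrict_mem isClosed_frontier.measurableSet] with y hy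
    rw [← Finset.sum_mul, ← Finset.sum_mul, hsum y (frontier_subset_closure hy), one_mul]
  rw [setIntegral_congr_fun hΩo.measurableSet hl, integral_congr_ae hr, integral_finsetSum,
    integral_finsetSum]
  · exact Finset.sum_congr rfl fun i hi => ((hζ i hi).2.2 u hu).1 v
  · intro i hi
    exact (integrable_surfaceMeasure_of_continuous hΩb (hcd i hi).continuous).mul_bdd (hmeas v)
      (ae_of_all _ fun y => norm_inner_outwardNormal_le Ω y v)
  · intro i hi
    exact integrableOn_of_continuous hΩb
      (((hcd i hi).continuous_fderiv one_ne_zero).clm_apply continuous_const)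

end Global

/-! ### Mollification -/

section Mollification

variable {d : ℕ}

/-- Translations are continuous in `L¹`. -/
theorem tendsto_eLpNorm_translate {f : Euc d → ℝ} (hf : MemLp f 1) :
    Tendsto (fun t : Euc d => eLpNorm (fun y => f (y - t) - f y) 1) (𝓝 0) (𝓝 0) := by
  have : Fact ((1 : ℝ≥0∞) ≠ ⊤) := ⟨ENNReal.one_ne_top⟩
  have hcont : Continuous fun t : Euc d => DomAddAct.mk t +ᵥ hf.toLp f :=
    DomAddAct.continuous_mk.vadd continuous_const
  have h1 : Tendsto (fun t : Euc d => edist (DomAddAct.mk (-t) +ᵥ hf.toLp f) (hf.toLp f))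
      (𝓝 0) (𝓝 0) := by
    have h2 : Tendsto (fun t : Euc d => edist (DomAddAct.mk (-t) +ᵥ hf.toLp f) (hf.toLp f))
        (𝓝 0) (𝓝 (edist (DomAddAct.mk (-0 : Euc d) +ᵥ hf.toLp f) (hf.toLp f))) :=
      ((hcont.comp continuous_neg).edist continuous_const).tendsto 0
    rwa [neg_zero, DomAddAct.mk_zero, zero_vadd, edist_self] at h2
  refine h1.congr fun t => ?_
  rw [DomAddAct.mk_vadd_toLp, Lp.edist_toLp_toLp]
  congr 1
  funext y
  simp [vadd_eq_add, sub_eq_add_neg, add_comm]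

/-- The convolution `∫ f(t) φ(y - t) dt`. -/
noncomputable def mollify (f φ : Euc d → ℝ) : Euc d → ℝ :=
  convolution f φ (ContinuousLinearMap.lsmul ℝ ℝ) volume

theorem mollify_apply (f φ : Euc d → ℝ) (y : Euc d) :
    mollify f φ y = ∫ t, f t * φ (y - t) := rfl

theorem mollify_apply' (f φ : Euc d → ℝ) (y : Euc d) :
    mollify f φ y = ∫ t, φ t * f (y - t) := by
  rw [mollify_apply, ← integral_sub_left_eq_self _ volume y]
  simp [mul_comm]

theorem contDiff_mollify {f φ : Euc d → ℝ} (hf : Integrable f) (hφ : ContDiff ℝ ∞ φ)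
    (hc : HasCompactSupport φ) : ContDiff ℝ ∞ (mollify f φ) :=
  hc.contDiff_convolution_right _ hf.locallyIntegrable hφ

theorem fderiv_mollify {f φ : Euc d → ℝ} (hf : Integrable f) (hφ : ContDiff ℝ 1 φ)
    (hc : HasCompactSupport φ) (y v : Euc d) :
    fderiv ℝ (mollify f φ) y v = ∫ t, f t * fderiv ℝ φ (y - t) v := by
  have h := hc.hasFDerivAt_convolution_right (ContinuousLinearMap.lsmul ℝ ℝ)
    hf.locallyIntegrable hφ y
  have h' : HasFDerivAt (mollify f φ) _ y := h
  rw [h'.fderiv, convolution_precompR_apply _ hf.locallyIntegrable (hc.fderiv (𝕜 := ℝ))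
    (hφ.continuous_fderiv one_ne_zero)]
  rfl

theorem integrable_mollify {f φ : Euc d → ℝ} (hf : Integrable f) (hφ : Integrable φ) :
    Integrable (mollify f φ) :=
  hf.integrable_convolution _ hφ

/-- The `L¹`-distance of `f` to its mollification is at most the modulus of continuity of the
translations of `f` on the support of the kernel. -/
theorem eLpNorm_mollify_sub_le {f φ : Euc d → ℝ} (hf : Integrable f) (hφc : Continuous φ)
    (hφs : HasCompactSupport φ) (hφ0 : ∀ t, 0 ≤ φ t) (hφ1 : ∫ t, φ t = 1) {η : ℝ≥0∞}
    (hη : ∀ t ∈ tsupport φ, eLpNorm (fun y => f (y - t) - f y) 1 ≤ η) :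
    eLpNorm (fun y => mollify f φ y - f y) 1 ≤ η := by
  -- choose a measurable representative
  obtain ⟨g, hgm, hfg⟩ := hf.aestronglyMeasurable
  have hg : Integrable g := hf.congr hfg
  have htr : ∀ t : Euc d, (fun y => f (y - t) - f y) =ᵐ[volume] fun y => g (y - t) - g y := by
    intro t
    have h := (measurePreserving_sub_right volume t).quasiMeasurePreserving.ae_eq_comp hfg
    filter_upwards [hfg, h] with y h1 h2
    rw [h1]
    exact congrArg (· - g y) h2
  have hη' : ∀ t ∈ tsupport φ, ∫⁻ y, ‖g (y - t) - g y‖ₑ ≤ η := fun t ht => by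
    rw [← eLpNorm_one_eq_lintegral_enorm, ← eLpNorm_congr_ae (htr t)]
    exact hη t ht
  have hmol : mollify f φ = mollify g φ :=
    convolution_congr _ hfg (ae_eq_refl φ)
  have hae : (fun y => mollify f φ y - f y) =ᵐ[volume] fun y => mollify g φ y - g y := by
    filter_upwards [hfg] with y hy
    rw [hmol, hy]
  rw [eLpNorm_congr_ae hae, eLpNorm_one_eq_lintegral_enorm]
  have hφi : Integrable φ := hφc.integrable_of_hasCompactSupport hφs
  have hloc : ∀ y, Integrable fun t => φ t * g (y - t) := by
    intro y
    have h := (hφs.convolutionExists_left (ContinuousLinearMap.lsmul ℝ ℝ) (μ := volume) hφc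
      hg.locallyIntegrable) y
    exact h
  have hpt : ∀ y, ‖mollify g φ y - g y‖ₑ ≤ ∫⁻ t, ‖φ t‖ₑ * ‖g (y - t) - g y‖ₑ := by
    intro y
    have h1 : mollify g φ y - g y = ∫ t, φ t * (g (y - t) - g y) := by
      simp only [mul_sub]
      rw [integral_sub (hloc y) (hφi.mul_const _), integral_mul_const, hφ1, one_mul,
        mollify_apply']
    rw [h1]
    refine (enorm_integral_le_lintegral_enorm _).trans_eq ?_
    simp only [enorm_mul]
  have hmeas : AEMeasurable (Function.uncurry fun (y t : Euc d) => ‖φ t‖ₑ * ‖g (y - t) - g y‖ₑ)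
      (volume.prod volume) := by
    refine Measurable.aemeasurable ?_
    have hg1 : Measurable fun p : Euc d × Euc d => g (p.1 - p.2) :=
      hgm.measurable.comp (measurable_fst.sub measurable_snd)
    exact (hφc.measurable.comp measurable_snd).enorm.mul
      (hg1.sub (hgm.measurable.comp measurable_fst)).enorm
  calc ∫⁻ y, ‖mollify g φ y - g y‖ₑ
      ≤ ∫⁻ y, ∫⁻ t, ‖φ t‖ₑ * ‖g (y - t) - g y‖ₑ := lintegral_mono hpt
    _ = ∫⁻ t, ∫⁻ y, ‖φ t‖ₑ * ‖g (y - t) - g y‖ₑ := lintegral_lintegral_swap hmeas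
    _ = ∫⁻ t, ‖φ t‖ₑ * ∫⁻ y, ‖g (y - t) - g y‖ₑ := by
        refine lintegral_congr fun t => ?_
        rw [lintegral_const_mul' _ _ enorm_ne_top]
    _ ≤ ∫⁻ t, ‖φ t‖ₑ * η := by
        refine lintegral_mono fun t => ?_
        by_cases ht : t ∈ tsupport φ
        · exact mul_le_mul_right (hη' t ht) _
        · simp [image_eq_zero_of_notMem_tsupport ht]
    _ = η := by
        have h1 : ∫⁻ t, ‖φ t‖ₑ = 1 := by
          have h2 := ofReal_integral_norm_eq_lintegral_enorm hφi
          simp only [Real.norm_of_nonneg (hφ0 _), hφ1, ENNReal.ofReal_one] at h2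
          exact h2.symm
        rw [lintegral_mul_const _ hφc.enorm.measurable, h1, one_mul]

/-- A normalized bump function supported in the closed ball of radius `δ a` around `δ c`. -/
noncomputable def conicKernel (c : Euc d) {a : ℝ} (ha : 0 < a) {δ : ℝ} (hδ : 0 < δ) :
    Euc d → ℝ :=
  (ContDiffBump.mk (c := δ • c) (δ * a / 2) (δ * a) (by positivity)
    (half_lt_self (by positivity))).normed volume

variable {c : Euc d} {a : ℝ} (ha : 0 < a)

theorem contDiff_conicKernel {δ : ℝ} (hδ : 0 < δ) : ContDiff ℝ ∞ (conicKernel c ha hδ) :=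
  ContDiffBump.contDiff_normed _

theorem tsupport_conicKernel {δ : ℝ} (hδ : 0 < δ) :
    tsupport (conicKernel c ha hδ) = Metric.closedBall (δ • c) (δ * a) :=
  ContDiffBump.tsupport_normed_eq _

theorem hasCompactSupport_conicKernel {δ : ℝ} (hδ : 0 < δ) :
    HasCompactSupport (conicKernel c ha hδ) :=
  ContDiffBump.hasCompactSupport_normed _

theorem tendsto_eLpNorm_mollify_conicKernel {f : Euc d → ℝ} (hf : Integrable f) {δ : ℕ → ℝ}
    (hδ : ∀ n, 0 < δ n) (hδ0 : Tendsto δ atTop (𝓝 0)) :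
    Tendsto (fun n => eLpNorm (fun y => mollify f (conicKernel c ha (hδ n)) y - f y) 1)
      atTop (𝓝 0) := by
  have htr := tendsto_eLpNorm_translate (memLp_one_iff_integrable.2 hf)
  rw [ENNReal.tendsto_nhds_zero] at htr ⊢
  intro η hη
  obtain ⟨ρ, hρ, hball⟩ := Metric.eventually_nhds_iff_ball.1 (htr η hη)
  have hlim : Tendsto (fun n => δ n * (‖c‖ + a)) atTop (𝓝 0) := by
    simpa using hδ0.mul_const (‖c‖ + a)
  filter_upwards [hlim.eventually (gt_mem_nhds hρ)] with n hn
  refine eLpNorm_mollify_sub_le hf (contDiff_conicKernel ha (hδ n)).continuous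
    (hasCompactSupport_conicKernel ha (hδ n)) (ContDiffBump.nonneg_normed _)
    (ContDiffBump.integral_normed _) fun t ht => hball t ?_
  rw [tsupport_conicKernel, mem_closedBall_iff_norm] at ht
  rw [mem_ball_zero_iff]
  have h1 : ‖t‖ ≤ ‖t - δ n • c‖ + ‖δ n • c‖ := by simpa using norm_add_le (t - δ n • c) (δ n • c)
  rw [norm_smul, Real.norm_of_nonneg (hδ n).le] at h1
  linarith

end Mollification

/-! ### Density of smooth functions -/

section Density

variable {d : ℕ} {Ω : Set (Euc d)}

/-- If the reflected and translated support of the kernel lies in `Ω`, then mollification commutes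
with the weak derivative. -/
theorem HasWeakPartial.fderiv_mollify {i : Fin d} {u g φ : Euc d → ℝ} (hΩo : IsOpen Ω)
    (hu : IntegrableOn u Ω) (h : HasWeakPartial Ω i u g) (hφ : ContDiff ℝ ∞ φ)
    (hc : HasCompactSupport φ) {y : Euc d} (hy : ∀ t ∈ tsupport φ, y - t ∈ Ω) :
    fderiv ℝ (mollify (Ω.indicator u) φ) y (EuclideanSpace.single i 1) =
      mollify (Ω.indicator g) φ y := by
  have hm := hΩo.measurableSet
  have hψ : ContDiff ℝ ∞ fun t => φ (y - t) := hφ.comp (contDiff_const.sub contDiff_id)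
  have hsub : tsupport (fun t => φ (y - t)) ⊆ (fun t => y - t) ⁻¹' tsupport φ :=
    closure_minimal (fun t ht => subset_tsupport φ ht)
      ((isClosed_tsupport φ).preimage (by fun_prop))
  have hψc : HasCompactSupport fun t => φ (y - t) :=
    hc.comp_homeomorph (Homeomorph.subLeft y)
  have hψs : tsupport (fun t => φ (y - t)) ⊆ Ω := fun t ht => by
    simpa using hy _ (hsub ht)
  have hd : ∀ t, fderiv ℝ (fun t => φ (y - t)) t (EuclideanSpace.single i 1) =
      -fderiv ℝ φ (y - t) (EuclideanSpace.single i 1) := fun t => by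
    have h1 : HasFDerivAt (fun t : Euc d => y - t) (-ContinuousLinearMap.id ℝ (Euc d)) t := by
      simpa using (hasFDerivAt_id t).const_sub y
    have h2 : HasFDerivAt (fun t => φ (y - t))
        ((fderiv ℝ φ (y - t)).comp (-ContinuousLinearMap.id ℝ (Euc d))) t :=
      (hφ.differentiable (by simp) (y - t)).hasFDerivAt.comp t h1
    rw [h2.fderiv]
    simp
  have key := h _ hψ hψc hψs
  simp only [hd, mul_neg, integral_neg, neg_inj] at key
  rw [MultiphaseShape.fderiv_mollify ((integrable_indicator_iff hm).2 hu)
    (hφ.of_le (by exact_mod_cast le_top)) hc, mollify_apply]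
  rw [← integral_indicator hm, ← integral_indicator hm] at key
  simpa only [indicator_mul_left] using key

/-- Near each point of its closure, a Lipschitz set contains the small translates of its points
by a truncated cone. -/
theorem IsLipschitzSet.exists_cone (hΩo : IsOpen Ω) (hΩ : IsLipschitzSet Ω) {x : Euc d}
    (hx : x ∈ closure Ω) :
    ∃ r > 0, ∃ c : Euc d, ∃ a > 0, ∃ δ₀ > 0, ∀ δ, 0 < δ → δ < δ₀ → ∀ y ∈ Ω ∩ Metric.ball x r,
      ∀ s ∈ Metric.closedBall (δ • c) (δ * a), y - s ∈ Ω := by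
  by_cases hxΩ : x ∈ Ω
  · obtain ⟨r, hr, hball⟩ := Metric.isOpen_iff.1 hΩo x hxΩ
    refine ⟨r / 2, by positivity, 0, 1, one_pos, r / 2, by positivity, ?_⟩
    intro δ hδ hδr y hy s hs
    rw [smul_zero, mem_closedBall_zero_iff, mul_one] at hs
    have h1 := mem_ball_iff_norm.1 hy.2
    refine hball (mem_ball_iff_norm.2 ?_)
    have h2 : ‖y - s - x‖ ≤ ‖y - x‖ + ‖s‖ := by
      rw [sub_right_comm]; exact norm_sub_le _ _
    linarith
  · have hxf : x ∈ frontier Ω := by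
      rw [hΩo.frontier_eq]; exact ⟨hx, hxΩ⟩
    obtain ⟨e, r, γ, ⟨he, hr, hepi⟩, K, hγ⟩ := hΩ x hxf
    refine ⟨r / 2, by positivity, -e, 1 / (1 + K), by positivity, r / 4, by positivity, ?_⟩
    intro δ hδ hδr y hy s hs
    rw [mem_closedBall_iff_norm, smul_neg, sub_neg_eq_add] at hs
    set p := s + δ • e with hp
    have hs' : s = p - δ • e := by rw [hp]; abel
    have hpK : (1 + K) * ‖p‖ ≤ δ := by
      have h := mul_le_mul_of_nonneg_left hs (by positivity : (0 : ℝ) ≤ 1 + K)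
      have h2 : (1 + (K : ℝ)) * (δ * (1 / (1 + K))) = δ := by field_simp
      linarith
    have hpδ : ‖p‖ ≤ δ := by nlinarith [norm_nonneg p, K.2, mul_nonneg K.2 (norm_nonneg p)]
    have hsn : ‖s‖ ≤ 2 * δ := by
      have h := norm_sub_le p (δ • e)
      rw [← hs', norm_smul, he, Real.norm_of_nonneg hδ.le] at h
      linarith
    have h1 := mem_ball_iff_norm.1 hy.2
    have hyball : y ∈ Metric.ball x r := mem_ball_iff_norm.2 (by linarith)
    have hmem : y - s ∈ Metric.ball x r := by
      refine mem_ball_iff_norm.2 ?_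
      have h2 : ‖y - s - x‖ ≤ ‖y - x‖ + ‖s‖ := by
        rw [sub_right_comm]; exact norm_sub_le _ _
      linarith
    have hyΩ := (hepi y hyball).1 hy.1
    rw [hepi _ hmem]
    have hee : inner ℝ e e = (1 : ℝ) := by rw [real_inner_self_eq_norm_sq, he, one_pow]
    have hin : inner ℝ e (y - s) = inner ℝ e y + δ - inner ℝ e p := by
      rw [hs', inner_sub_right, inner_sub_right, inner_smul_right, hee]; ring
    have hproj : (y - s - inner ℝ e (y - s) • e) - (y - inner ℝ e y • e) =
        -(hyperplaneProj e p : Euc d) := by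
      rw [hin, coe_hyperplaneProj he, hs']
      module
    have hlip : γ (y - s - inner ℝ e (y - s) • e) - γ (y - inner ℝ e y • e) ≤ K * ‖p‖ := by
      have h := hγ.dist_le_mul (y - s - inner ℝ e (y - s) • e) (y - inner ℝ e y • e)
      rw [dist_eq_norm, dist_eq_norm, hproj, norm_neg] at h
      have h2 : ‖(hyperplaneProj e p : Euc d)‖ ≤ ‖p‖ :=
        Submodule.norm_orthogonalProjectionOnto_apply_le _ p
      exact (le_abs_self _).trans (h.trans (mul_le_mul_of_nonneg_left h2 K.2))
    have hcs : |inner ℝ e p| ≤ ‖p‖ := by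
      have := abs_real_inner_le_norm e p
      rwa [he, one_mul] at this
    have := le_abs_self (inner ℝ e p)
    linarith

theorem MemW11.weakPartial_spec {u : Euc d → ℝ} (hu : MemW11 Ω u) (i : Fin d) :
    IntegrableOn (weakPartial Ω i u) Ω ∧ HasWeakPartial Ω i u (weakPartial Ω i u) := by
  have h := hu.2 i
  rw [weakPartial, dif_pos h]
  exact h.choose_spec

theorem tendsto_eLpNorm_sum_mul {α ι : Type*} [MeasurableSpace α] {μ : Measure α} (t : Finset ι)
    {ζ : ι → α → ℝ} {F : ι → ℕ → α → ℝ} (hζm : ∀ i ∈ t, AEStronglyMeasurable (ζ i) μ)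
    (hζ : ∀ i ∈ t, ∃ M : ℝ, ∀ᵐ y ∂μ, ‖ζ i y‖ ≤ M)
    (hFm : ∀ i ∈ t, ∀ n, AEStronglyMeasurable (F i n) μ)
    (hF : ∀ i ∈ t, Tendsto (fun n => eLpNorm (F i n) 1 μ) atTop (𝓝 0)) :
    Tendsto (fun n => eLpNorm (fun y => ∑ i ∈ t, ζ i y * F i n y) 1 μ) atTop (𝓝 0) := by
  choose! M hM using hζ
  have hlim : Tendsto (fun n => ∑ i ∈ t, ENNReal.ofReal (M i) * eLpNorm (F i n) 1 μ) atTop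
      (𝓝 (∑ i ∈ t, ENNReal.ofReal (M i) * 0)) :=
    tendsto_finsetSum _ fun i hi =>
      ENNReal.Tendsto.const_mul (hF i hi) (Or.inr ENNReal.ofReal_ne_top)
  simp only [mul_zero, Finset.sum_const_zero] at hlim
  refine tendsto_of_tendsto_of_tendsto_of_le_of_le tendsto_const_nhds hlim (fun _ => zero_le)
    fun n => ?_
  have h1 : (fun y => ∑ i ∈ t, ζ i y * F i n y) = ∑ i ∈ t, fun y => ζ i y * F i n y := by
    funext y
    simp
  rw [h1]
  refine (eLpNorm_sum_le (fun i hi => (hζm i hi).mul (hFm i hi n)) le_rfl).trans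
    (Finset.sum_le_sum fun i hi => ?_)
  refine eLpNorm_le_mul_eLpNorm_of_ae_le_mul ?_ 1
  filter_upwards [hM i hi] with y hy
  change ‖ζ i y * F i n y‖ ≤ _
  rw [norm_mul]
  exact mul_le_mul_of_nonneg_right hy (norm_nonneg _)

/-- **Density of smooth functions.** On a bounded Lipschitz set, every function in `W^{1,1}` is the
limit in `W^{1,1}` of functions that are smooth up to the boundary: glue, by a partition of unity,
mollifications with kernels whose supports are translated into the cones pointing inwards. -/
theorem IsLipschitzSet.exists_smooth_approx (hΩo : IsOpen Ω) (hΩb : Bornology.IsBounded Ω)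
    (hΩ : IsLipschitzSet Ω) {u : Euc d → ℝ} (hu : MemW11 Ω u) :
    ∃ v : ℕ → Euc d → ℝ, (∀ n, ContDiff ℝ ∞ (v n)) ∧
      Tendsto (fun n => eLpNorm (fun y => v n y - u y) 1 (volume.restrict Ω)) atTop (𝓝 0) ∧
      ∀ j, Tendsto (fun n => eLpNorm (fun y => fderiv ℝ (v n) y (EuclideanSpace.single j 1) -
        weakPartial Ω j u y) 1 (volume.restrict Ω)) atTop (𝓝 0) := by
  classical
  have hm := hΩo.measurableSet
  have hloc := fun (x : Euc d) (hx : x ∈ closure Ω) => hΩ.exists_cone hΩo hx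
  choose! r hr c a ha δ₀ hδ₀ hcone using hloc
  obtain ⟨t, ζ, hts, hζ, hsum⟩ := exists_smooth_partition_of_unity hΩb.isCompact_closure hr
  set δ : ℕ → ℝ := fun n => 1 / ((n : ℝ) + 1) with hδdef
  have hδ : ∀ n, 0 < δ n := fun n => by positivity
  have hδ0 : Tendsto δ atTop (𝓝 0) := tendsto_one_div_add_atTop_nhds_zero_nat
  -- the kernel for a point outside the closure plays no role
  set A : Euc d → ℝ := fun i => if 0 < a i then a i else 1 with hA
  have hApos : ∀ i, 0 < A i := fun i => by
    simp only [hA]; split_ifs with h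
    · exact h
    · exact one_pos
  have hAeq : ∀ i ∈ t, A i = a i := fun i hi => if_pos (ha i (hts i hi))
  set φ : Euc d → ℕ → Euc d → ℝ := fun i n => conicKernel (c i) (hApos i) (hδ n) with hφdef
  have hφ : ∀ i n, ContDiff ℝ ∞ (φ i n) := fun i n => contDiff_conicKernel _ _
  have hφc : ∀ i n, HasCompactSupport (φ i n) := fun i n => hasCompactSupport_conicKernel _ _
  set U : Euc d → ℝ := Ω.indicator u with hU
  have hUi : Integrable U := (integrable_indicator_iff hm).2 hu.1
  have hζ1 : ∀ i ∈ t, ContDiff ℝ 1 (ζ i) := fun i hi => (hζ i hi).1.of_le (by exact_mod_cast le_top)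
  have hsm : ∀ i n, ContDiff ℝ ∞ (mollify U (φ i n)) := fun i n =>
    contDiff_mollify hUi (hφ i n) (hφc i n)
  -- convergence of the local approximations
  have hconv : ∀ f : Euc d → ℝ, IntegrableOn f Ω → ∀ i ∈ t,
      Tendsto (fun n => eLpNorm (fun y => mollify (Ω.indicator f) (φ i n) y - f y) 1
        (volume.restrict Ω)) atTop (𝓝 0) := by
    intro f hf i _
    have h := tendsto_eLpNorm_mollify_conicKernel (c := c i) (hApos i)
      ((integrable_indicator_iff hm).2 hf) hδ hδ0
    refine tendsto_of_tendsto_of_tendsto_of_le_of_le tendsto_const_nhds h (fun _ => zero_le)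
      fun n => ?_
    refine le_trans (le_of_eq (eLpNorm_congr_ae ?_))
      (eLpNorm_mono_measure _ Measure.restrict_le_self)
    filter_upwards [ae_restrict_mem hm] with y hy
    rw [indicator_of_mem hy]
  have hmeas : ∀ f : Euc d → ℝ, IntegrableOn f Ω → ∀ i ∈ t, ∀ n, AEStronglyMeasurable
      (fun y => mollify (Ω.indicator f) (φ i n) y - f y) (volume.restrict Ω) := by
    intro f hf i _ n
    exact (integrable_mollify ((integrable_indicator_iff hm).2 hf)
      ((hφ i n).continuous.integrable_of_hasCompactSupport
        (hφc i n))).aestronglyMeasurable.restrict.sub hf.aestronglyMeasurable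
  have hζm : ∀ i ∈ t, AEStronglyMeasurable (ζ i) (volume.restrict Ω) := fun i hi =>
    (hζ i hi).1.continuous.aestronglyMeasurable
  have hζb : ∀ i ∈ t, ∃ M : ℝ, ∀ᵐ y ∂(volume.restrict Ω), ‖ζ i y‖ ≤ M := fun i hi => by
    obtain ⟨M, hM⟩ := (hζ i hi).2.1.exists_bound_of_continuous (hζ i hi).1.continuous
    exact ⟨M, ae_of_all _ hM⟩
  refine ⟨fun n y => ∑ i ∈ t, ζ i y * mollify U (φ i n) y, fun n =>
    ContDiff.sum fun i hi => (hζ i hi).1.mul (hsm i n), ?_, fun j => ?_⟩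
  · refine (tendsto_eLpNorm_sum_mul t hζm hζb (hmeas u hu.1) (hconv u hu.1)).congr fun n => ?_
    refine eLpNorm_congr_ae ?_
    filter_upwards [ae_restrict_mem hm] with y hy
    simp only [mul_sub, Finset.sum_sub_distrib]
    rw [← Finset.sum_mul, hsum y (subset_closure hy), one_mul]
  · obtain ⟨hgi, hg⟩ := hu.weakPartial_spec j
    set g := weakPartial Ω j u
    set ej : Euc d := EuclideanSpace.single j 1
    have hdm : ∀ i ∈ t, AEStronglyMeasurable (fun y => fderiv ℝ (ζ i) y ej)
        (volume.restrict Ω) := fun i hi =>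
      (((hζ1 i hi).continuous_fderiv one_ne_zero).clm_apply
        continuous_const).aestronglyMeasurable
    have hdb : ∀ i ∈ t, ∃ M : ℝ, ∀ᵐ y ∂(volume.restrict Ω), ‖fderiv ℝ (ζ i) y ej‖ ≤ M :=
      fun i hi => by
        obtain ⟨M, hM⟩ := ((hζ i hi).2.1.fderiv_apply (𝕜 := ℝ) ej).exists_bound_of_continuous
          (((hζ1 i hi).continuous_fderiv one_ne_zero).clm_apply continuous_const)
        exact ⟨M, ae_of_all _ hM⟩
    have h1 := tendsto_eLpNorm_sum_mul t hdm hdb (hmeas u hu.1) (hconv u hu.1)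
    have h2 := tendsto_eLpNorm_sum_mul t hζm hζb (hmeas g hgi) (hconv g hgi)
    have h12 := h1.add h2
    rw [add_zero] at h12
    have hevent : ∀ᶠ n in atTop, ∀ i ∈ t, δ n < δ₀ i :=
      (Filter.eventually_all_finset t).2 fun i hi =>
        hδ0.eventually (gt_mem_nhds (hδ₀ i (hts i hi)))
    refine tendsto_of_tendsto_of_tendsto_of_le_of_le' tendsto_const_nhds h12
      (Eventually.of_forall fun _ => zero_le) ?_
    filter_upwards [hevent] with n hn
    refine le_trans (le_of_eq (eLpNorm_congr_ae ?_)) (eLpNorm_add_le ?_ ?_ le_rfl)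
    · filter_upwards [ae_restrict_mem hm] with y hy
      have hd : ∀ i ∈ t, HasFDerivAt (fun y => ζ i y * mollify U (φ i n) y)
          (ζ i y • fderiv ℝ (mollify U (φ i n)) y + mollify U (φ i n) y • fderiv ℝ (ζ i) y) y :=
        fun i hi => ((hζ i hi).1.differentiable (by simp) y).hasFDerivAt.mul
          ((hsm i n).differentiable (by simp) y).hasFDerivAt
      rw [(HasFDerivAt.fun_sum hd).fderiv]
      have hzero : ∑ i ∈ t, fderiv ℝ (ζ i) y ej = 0 := by
        have heq : (fun y => ∑ i ∈ t, ζ i y) =ᶠ[𝓝 y] fun _ => (1 : ℝ) := by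
          filter_upwards [hΩo.mem_nhds hy] with w hw
          exact hsum w (subset_closure hw)
        have h3 := heq.fderiv_eq (𝕜 := ℝ)
        rw [fderiv_fun_sum fun i hi => (hζ i hi).1.differentiable (by simp) y] at h3
        have h4 := congrArg (fun L : Euc d →L[ℝ] ℝ => L ej) h3
        simpa [sum_apply] using h4
      have hterm : ∀ i ∈ t, ζ i y * fderiv ℝ (mollify U (φ i n)) y ej =
          ζ i y * mollify (Ω.indicator g) (φ i n) y := by
        intro i hi
        by_cases hyi : y ∈ tsupport (ζ i)
        · congr 1
          refine hg.fderiv_mollify hΩo hu.1 (hφ i n) (hφc i n) fun s hs => ?_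
          rw [hφdef, tsupport_conicKernel, hAeq i hi] at hs
          exact hcone i (hts i hi) (δ n) (hδ n) (hn i hi) y ⟨hy, (hζ i hi).2.2 hyi⟩ s hs
        · rw [image_eq_zero_of_notMem_tsupport hyi, zero_mul, zero_mul]
      have hone : g y = ∑ i ∈ t, ζ i y * g y := by
        rw [← Finset.sum_mul, hsum y (subset_closure hy), one_mul]
      have hzu : ∑ i ∈ t, fderiv ℝ (ζ i) y ej * u y = 0 := by
        rw [← Finset.sum_mul, hzero, zero_mul]
      simp only [sum_apply, add_apply, smul_apply, smul_eq_mul, Pi.add_apply, mul_sub,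
        Finset.sum_sub_distrib, Finset.sum_add_distrib]
      rw [hzu, Finset.sum_congr rfl hterm, ← hone,
        Finset.sum_congr rfl fun i _ => mul_comm (mollify U (φ i n) y) (fderiv ℝ (ζ i) y ej)]
      ring
    · exact Finset.aestronglyMeasurable_fun_sum _ fun i hi => (hdm i hi).mul (hmeas u hu.1 i hi n)
    · exact Finset.aestronglyMeasurable_fun_sum _ fun i hi => (hζm i hi).mul (hmeas g hgi i hi n)

end Density

/-! ### Traces and integration by parts -/

section Trace

variable {d : ℕ} {Ω : Set (Euc d)}

theorem norm_le_sum_norm_apply_single (L : Euc d →L[ℝ] ℝ) :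
    ‖L‖ ≤ ∑ j, ‖L (EuclideanSpace.single j 1)‖ := by
  refine L.opNorm_le_bound (Finset.sum_nonneg fun _ _ => norm_nonneg _) fun x => ?_
  have hx : x = ∑ j, x j • EuclideanSpace.single j (1 : ℝ) := by
    conv_lhs => rw [← (EuclideanSpace.basisFun (Fin d) ℝ).sum_repr x]
    simp
  have h1 : L x = ∑ j, x j * L (EuclideanSpace.single j 1) := by
    conv_lhs => rw [hx]
    simp
  rw [h1, Finset.sum_mul]
  refine (norm_sum_le _ _).trans (Finset.sum_le_sum fun j _ => ?_)
  rw [norm_mul, mul_comm]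
  exact mul_le_mul_of_nonneg_left (PiLp.norm_apply_le x j) (norm_nonneg _)

/-- **Existence of traces.** By the trace inequality, the boundary values of smooth approximations
form a Cauchy sequence in `L¹(∂Ω)`. -/
theorem IsLipschitzSet.exists_isTrace (hΩo : IsOpen Ω) (hΩb : Bornology.IsBounded Ω)
    (hΩ : IsLipschitzSet Ω) {u : Euc d → ℝ} (hu : MemW11 Ω u) : ∃ g, IsTrace Ω u g := by
  have := hΩ.isFiniteMeasure_surfaceMeasure hΩo hΩb
  obtain ⟨v, hv, hv0, hv1⟩ := hΩ.exists_smooth_approx hΩo hΩb hu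
  obtain ⟨C, hC⟩ := hΩ.exists_lintegral_surfaceMeasure_le hΩo hΩb
  set g := fun j => weakPartial Ω j u with hg
  set ej : Fin d → Euc d := fun j => EuclideanSpace.single j 1 with hej
  have hv' : ∀ n, ContDiff ℝ 1 (v n) := fun n => (hv n).of_le (by exact_mod_cast le_top)
  set b : ℕ → ℝ≥0∞ := fun n => eLpNorm (fun y => v n y - u y) 1 (volume.restrict Ω) +
    ∑ j, eLpNorm (fun y => fderiv ℝ (v n) y (ej j) - g j y) 1 (volume.restrict Ω) with hb
  have hb0 : Tendsto b atTop (𝓝 0) := by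
    have h := hv0.add (tendsto_finsetSum Finset.univ fun j _ => hv1 j)
    simpa using h
  have hm0 : ∀ n, AEStronglyMeasurable (fun y => v n y - u y) (volume.restrict Ω) := fun n =>
    (hv n).continuous.aestronglyMeasurable.sub hu.1.aestronglyMeasurable
  have hdc : ∀ n j, Continuous fun y => fderiv ℝ (v n) y (ej j) := fun n j =>
    ((hv' n).continuous_fderiv one_ne_zero).clm_apply continuous_const
  have hm1 : ∀ n j, AEStronglyMeasurable (fun y => fderiv ℝ (v n) y (ej j) - g j y)
      (volume.restrict Ω) := fun n j =>
    (hdc n j).aestronglyMeasurable.sub (hu.weakPartial_spec j).1.aestronglyMeasurable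
  have hdiff : ∀ n m, eLpNorm (fun y => v n y - v m y) 1 (surfaceMeasure Ω) ≤ C * (b n + b m) := by
    intro n m
    rw [eLpNorm_one_eq_lintegral_enorm]
    refine (hC _ ((hv' n).sub (hv' m))).trans (mul_le_mul_right ?_ _)
    have h0 : ∫⁻ y in Ω, ‖v n y - v m y‖ₑ ≤ eLpNorm (fun y => v n y - u y) 1 (volume.restrict Ω) +
        eLpNorm (fun y => v m y - u y) 1 (volume.restrict Ω) := by
      rw [← eLpNorm_one_eq_lintegral_enorm]
      refine le_trans (le_of_eq ?_) (eLpNorm_sub_le (hm0 n) (hm0 m) le_rfl)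
      congr 1
      funext y
      simp
    have h1 : ∀ j, ∫⁻ y in Ω, ‖fderiv ℝ (v n) y (ej j) - fderiv ℝ (v m) y (ej j)‖ₑ ≤
        eLpNorm (fun y => fderiv ℝ (v n) y (ej j) - g j y) 1 (volume.restrict Ω) +
        eLpNorm (fun y => fderiv ℝ (v m) y (ej j) - g j y) 1 (volume.restrict Ω) := fun j => by
      rw [← eLpNorm_one_eq_lintegral_enorm]
      refine le_trans (le_of_eq ?_) (eLpNorm_sub_le (hm1 n j) (hm1 m j) le_rfl)
      congr 1
      funext y
      simp
    have h2 : ∫⁻ y in Ω, ‖fderiv ℝ (fun y => v n y - v m y) y‖ₑ ≤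
        ∑ j, ∫⁻ y in Ω, ‖fderiv ℝ (v n) y (ej j) - fderiv ℝ (v m) y (ej j)‖ₑ := by
      have hm : ∀ j, Measurable fun y =>
          ‖fderiv ℝ (v n) y (ej j) - fderiv ℝ (v m) y (ej j)‖ₑ := fun j =>
        ((hdc n j).sub (hdc m j)).enorm.measurable
      rw [← lintegral_finsetSum _ fun j _ => hm j]
      refine lintegral_mono fun y => ?_
      rw [fderiv_fun_sub ((hv' n).differentiable one_ne_zero y)
        ((hv' m).differentiable one_ne_zero y)]
      simp only [← ofReal_norm]
      rw [← ENNReal.ofReal_sum_of_nonneg fun _ _ => norm_nonneg _]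
      exact ENNReal.ofReal_le_ofReal (norm_le_sum_norm_apply_single _)
    refine (add_le_add h0 (h2.trans (Finset.sum_le_sum fun j _ => h1 j))).trans (le_of_eq ?_)
    rw [Finset.sum_add_distrib, hb]
    ring
  have hLp : ∀ n, MemLp (v n) 1 (surfaceMeasure Ω) := fun n =>
    memLp_one_iff_integrable.2 (integrable_surfaceMeasure_of_continuous hΩb (hv n).continuous)
  have hcauchy : CauchySeq fun n => (hLp n).toLp (v n) := by
    rw [EMetric.cauchySeq_iff]
    intro ε hε
    have hhalf : Tendsto (fun p : ℕ × ℕ => C * (b p.1 + b p.2)) atTop (𝓝 0) := by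
      rw [← prod_atTop_atTop_eq]
      have h := ENNReal.Tendsto.const_mul ((hb0.comp tendsto_fst).add
        (hb0.comp (tendsto_snd (f := (atTop : Filter ℕ))))) (a := (C : ℝ≥0∞))
        (Or.inr ENNReal.coe_ne_top)
      simpa using h
    obtain ⟨⟨N₁, N₂⟩, hN⟩ := eventually_atTop.1 (hhalf.eventually (gt_mem_nhds hε))
    refine ⟨max N₁ N₂, fun m hm n hn => ?_⟩
    rw [Lp.edist_toLp_toLp]
    exact (hdiff m n).trans_lt
      (hN (m, n) ⟨(le_max_left _ _).trans hm, (le_max_right _ _).trans hn⟩)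
  obtain ⟨G, hG⟩ := cauchySeq_tendsto_of_complete hcauchy
  refine ⟨G, hu, memLp_one_iff_integrable.1 (Lp.memLp G), v, hv, hv0, hv1, ?_⟩
  have h := tendsto_iff_edist_tendsto_0.1 hG
  refine h.congr fun n => ?_
  rw [Lp.edist_def]
  refine eLpNorm_congr_ae ?_
  filter_upwards [(hLp n).coeFn_toLp] with y hy
  rw [Pi.sub_apply, hy]

theorem tendsto_integral_mul_of_eLpNorm {α : Type*} [MeasurableSpace α] {μ : Measure α}
    {F : ℕ → α → ℝ} {f m : α → ℝ} {M : ℝ} (hf : Integrable f μ) (hF : ∀ n, Integrable (F n) μ)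
    (hm : AEStronglyMeasurable m μ) (hM : ∀ᵐ x ∂μ, ‖m x‖ ≤ M)
    (h : Tendsto (fun n => eLpNorm (fun x => F n x - f x) 1 μ) atTop (𝓝 0)) :
    Tendsto (fun n => ∫ x, m x * F n x ∂μ) atTop (𝓝 (∫ x, m x * f x ∂μ)) := by
  refine tendsto_integral_of_L1' _ (hf.bdd_mul hm hM).aestronglyMeasurable
    (Eventually.of_forall fun n => (hF n).bdd_mul hm hM) ?_
  have h1 := tendsto_eLpNorm_sum_mul (μ := μ) (Finset.univ : Finset Unit) (ζ := fun _ => m)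
    (F := fun _ n x => F n x - f x) (fun _ _ => hm) (fun _ _ => ⟨M, hM⟩)
    (fun _ _ n => (hF n).aestronglyMeasurable.sub hf.aestronglyMeasurable) (fun _ _ => h)
  refine h1.congr fun n => ?_
  congr 1
  funext x
  simp [mul_sub]

theorem exists_bound_ae_restrict (hΩo : IsOpen Ω) (hΩb : Bornology.IsBounded Ω) {f : Euc d → ℝ}
    (hf : Continuous f) : ∃ M : ℝ, ∀ᵐ y ∂(volume.restrict Ω), ‖f y‖ ≤ M := by
  obtain ⟨M, hM⟩ := hΩb.isCompact_closure.exists_bound_of_continuousOn hf.continuousOn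
  refine ⟨M, ?_⟩
  filter_upwards [ae_restrict_mem hΩo.measurableSet] with y hy using hM y (subset_closure hy)

theorem exists_bound_ae_surfaceMeasure (hΩb : Bornology.IsBounded Ω) {f : Euc d → ℝ}
    (hf : Continuous f) : ∃ M : ℝ, ∀ᵐ y ∂(surfaceMeasure Ω), ‖f y‖ ≤ M := by
  obtain ⟨M, hM⟩ := hΩb.isCompact_closure.exists_bound_of_continuousOn hf.continuousOn
  refine ⟨M, ?_⟩
  rw [surfaceMeasure]
  filter_upwards [ae_restrict_mem isClosed_frontier.measurableSet] with y hy
    using hM y (frontier_subset_closure hy)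

theorem outwardNormal_apply_eq_inner (Ω : Set (Euc d)) (y : Euc d) (j : Fin d) :
    outwardNormal Ω y j = inner ℝ (outwardNormal Ω y) (EuclideanSpace.single j (1 : ℝ)) := by
  rw [EuclideanSpace.inner_single_right]
  simp

theorem IsTrace.integrable_mul (hΩo : IsOpen Ω) (hΩb : Bornology.IsBounded Ω)
    (hΩ : IsLipschitzSet Ω) {u T θ : Euc d → ℝ} (hT : IsTrace Ω u T) (hθ : Continuous θ)
    (j : Fin d) :
    Integrable (fun y => T y * outwardNormal Ω y j * θ y) (surfaceMeasure Ω) := by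
  obtain ⟨M, hM⟩ := exists_bound_ae_surfaceMeasure hΩb hθ
  refine Integrable.mul_bdd ?_ hθ.aestronglyMeasurable hM
  simp only [outwardNormal_apply_eq_inner]
  exact hT.2.1.mul_bdd (hΩ.aestronglyMeasurable_inner_outwardNormal hΩo hΩb _)
    (ae_of_all _ fun y => norm_inner_outwardNormal_le Ω y _)

/-- **Integration by parts** on a bounded Lipschitz set, for a function in `W^{1,1}` with its
trace. -/
theorem IsTrace.setIntegral_eq (hΩo : IsOpen Ω) (hΩb : Bornology.IsBounded Ω)
    (hΩ : IsLipschitzSet Ω) {u T θ : Euc d → ℝ} (hT : IsTrace Ω u T) (hθ : ContDiff ℝ 1 θ)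
    (j : Fin d) :
    ∫ y in Ω, (weakPartial Ω j u y * θ y + u y * fderiv ℝ θ y (EuclideanSpace.single j 1)) =
      ∫ y, T y * outwardNormal Ω y j * θ y ∂(surfaceMeasure Ω) := by
  have := hΩ.isFiniteMeasure_surfaceMeasure hΩo hΩb
  obtain ⟨hu, hTi, v, hv, hv0, hv1, hvT⟩ := hT
  set ej : Euc d := EuclideanSpace.single j 1
  obtain ⟨hgi, -⟩ := hu.weakPartial_spec j
  have hv' : ∀ n, ContDiff ℝ 1 (v n) := fun n => (hv n).of_le (by exact_mod_cast le_top)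
  have hdc : ∀ f : Euc d → ℝ, ContDiff ℝ 1 f → Continuous fun y => fderiv ℝ f y ej := fun f hf =>
    (hf.continuous_fderiv one_ne_zero).clm_apply continuous_const
  obtain ⟨M₀, hM₀⟩ := exists_bound_ae_restrict hΩo hΩb hθ.continuous
  obtain ⟨M₁, hM₁⟩ := exists_bound_ae_restrict hΩo hΩb (hdc θ hθ)
  obtain ⟨M₂, hM₂⟩ := exists_bound_ae_surfaceMeasure hΩb hθ.continuous
  have hnm := hΩ.aestronglyMeasurable_inner_outwardNormal hΩo hΩb ej
  have hl1 := tendsto_integral_mul_of_eLpNorm hgi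
    (fun n => integrableOn_of_continuous hΩb (hdc _ (hv' n)))
    hθ.continuous.aestronglyMeasurable hM₀ (hv1 j)
  have hl2 := tendsto_integral_mul_of_eLpNorm hu.1
    (fun n => integrableOn_of_continuous hΩb (hv n).continuous)
    (hdc θ hθ).aestronglyMeasurable hM₁ hv0
  have hr := tendsto_integral_mul_of_eLpNorm (m := fun y => θ y * inner ℝ (outwardNormal Ω y) ej)
    (M := M₂ * ‖ej‖) hTi
    (fun n => integrable_surfaceMeasure_of_continuous hΩb (hv n).continuous)
    (hθ.continuous.aestronglyMeasurable.mul hnm) (by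
      filter_upwards [hM₂] with y hy
      rw [norm_mul]
      exact mul_le_mul hy (norm_inner_outwardNormal_le Ω y ej) (norm_nonneg _)
        ((norm_nonneg _).trans hy)) hvT
  have hl := hl1.add hl2
  have heq : ∀ n, (∫ y in Ω, θ y * fderiv ℝ (v n) y ej) + ∫ y in Ω, fderiv ℝ θ y ej * v n y =
      ∫ y, θ y * inner ℝ (outwardNormal Ω y) ej * v n y ∂(surfaceMeasure Ω) := by
    intro n
    have h := hΩ.setIntegral_fderiv hΩo hΩb (hθ.mul (hv' n)) ej
    have h1 : ∀ y, fderiv ℝ (fun y => θ y * v n y) y ej =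
        θ y * fderiv ℝ (v n) y ej + fderiv ℝ θ y ej * v n y := fun y => by
      rw [fderiv_fun_mul (hθ.differentiable one_ne_zero y) ((hv' n).differentiable one_ne_zero y)]
      simp [mul_comm]
    simp only [h1] at h
    rw [integral_add] at h
    · rw [h]
      refine integral_congr_ae (ae_of_all _ fun y => ?_)
      simp only
      ring
    · exact integrableOn_of_continuous hΩb (hθ.continuous.mul (hdc _ (hv' n)))
    · exact integrableOn_of_continuous hΩb ((hdc θ hθ).mul (hv n).continuous)
  simp only [heq] at hl
  have hfin := tendsto_nhds_unique hl hr
  rw [← integral_add (hgi.bdd_mul hθ.continuous.aestronglyMeasurable hM₀)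
    (Integrable.bdd_mul hu.1 (hdc θ hθ).aestronglyMeasurable hM₁)] at hfin
  simp only [outwardNormal_apply_eq_inner]
  convert hfin using 3 <;> ring

end Trace

/-! ### Product rule and uniqueness for weak derivatives -/

section WeakProduct

variable {d : ℕ} {Ω : Set (Euc d)} {i : Fin d} {u g : Euc d → ℝ}

/-- A weak derivative may be tested against functions that are only of class `C¹`, since these are
limits in `C¹` of smooth functions supported in a slightly larger set. -/
theorem HasWeakPartial.integral_contDiff_one (hΩo : IsOpen Ω) (hu : IntegrableOn u Ω)
    (hg : IntegrableOn g Ω) (h : HasWeakPartial Ω i u g) {φ : Euc d → ℝ} (hφ : ContDiff ℝ 1 φ)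
    (hc : HasCompactSupport φ) (hs : tsupport φ ⊆ Ω) :
    ∫ x in Ω, u x * fderiv ℝ φ x (EuclideanSpace.single i 1) = -∫ x in Ω, g x * φ x := by
  set ei : Euc d := EuclideanSpace.single i 1
  set B : ℕ → ContDiffBump (0 : Euc d) := fun n =>
    ContDiffBump.mk (1 / ((n : ℝ) + 1) / 2) (1 / ((n : ℝ) + 1)) (by positivity)
      (half_lt_self (by positivity)) with hB
  have hBlim : Tendsto (fun n => (B n).rOut) atTop (𝓝 0) := tendsto_one_div_add_atTop_nhds_zero_nat
  set k : ℕ → Euc d → ℝ := fun n => (B n).normed volume with hk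
  have hki : ∀ n, Integrable (k n) := fun n => (B n).integrable_normed
  have hdc : Continuous fun y => fderiv ℝ φ y ei :=
    (hφ.continuous_fderiv one_ne_zero).clm_apply continuous_const
  have hsm : ∀ n, ContDiff ℝ ∞ (mollify (k n) φ) := fun n =>
    (B n).hasCompactSupport_normed.contDiff_convolution_left _ (B n).contDiff_normed
      (hφ.continuous.locallyIntegrable)
  have hcs : ∀ n, HasCompactSupport (mollify (k n) φ) := fun n =>
    (B n).hasCompactSupport_normed.convolution _ hc
  have hpt : ∀ f : Euc d → ℝ, Continuous f → ∀ y,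
      Tendsto (fun n => mollify (k n) f y) atTop (𝓝 (f y)) := fun f hf y =>
    ContDiffBump.convolution_tendsto_right_of_continuous hBlim hf y
  have hbd : ∀ f : Euc d → ℝ, ∀ M : ℝ, (∀ y, ‖f y‖ ≤ M) → ∀ n y, ‖mollify (k n) f y‖ ≤ M := by
    intro f M hM n y
    have h1 : ∀ t, ‖k n t * f (y - t)‖ ≤ k n t * M := fun t => by
      rw [norm_mul, Real.norm_of_nonneg ((B n).nonneg_normed t)]
      exact mul_le_mul_of_nonneg_left (hM _) ((B n).nonneg_normed t)
    refine (norm_integral_le_of_norm_le ((hki n).mul_const M) (ae_of_all _ h1)).trans_eq ?_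
    rw [integral_mul_const, (B n).integral_normed, one_mul]
  have hfd : ∀ n y, fderiv ℝ (mollify (k n) φ) y ei = mollify (k n) (fun y => fderiv ℝ φ y ei) y :=
    fun n y => MultiphaseShape.fderiv_mollify (hki n) hφ hc y ei
  obtain ⟨M₀, hM₀⟩ := hc.exists_bound_of_continuous hφ.continuous
  obtain ⟨M₁, hM₁⟩ := (hc.fderiv_apply (𝕜 := ℝ) ei).exists_bound_of_continuous hdc
  -- for large `n` the mollified function is supported in `Ω`
  obtain ⟨ρ, hρ, hthick⟩ := hc.exists_cthickening_subset_open hΩo hs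
  have hsupp : ∀ᶠ n in atTop, tsupport (mollify (k n) φ) ⊆ Ω := by
    filter_upwards [hBlim.eventually (gt_mem_nhds hρ)] with n hn
    refine Subset.trans (closure_minimal (fun y hy => ?_) Metric.isClosed_cthickening) hthick
    obtain ⟨t, ht, w, hw, rfl⟩ := support_convolution_subset _ hy
    rw [Function.mem_support] at ht
    have ht' : t ∈ Metric.ball (0 : Euc d) (B n).rOut := by
      rw [← (B n).support_normed_eq (μ := volume)]; exact ht
    refine Metric.mem_cthickening_of_dist_le _ w _ _ (subset_tsupport _ hw) ?_
    rw [dist_eq_norm, add_sub_cancel_right]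
    exact ((mem_ball_zero_iff.1 ht').trans hn).le
  have hl : Tendsto (fun n => ∫ x in Ω, u x * fderiv ℝ (mollify (k n) φ) x ei) atTop
      (𝓝 (∫ x in Ω, u x * fderiv ℝ φ x ei)) := by
    refine tendsto_integral_of_dominated_convergence (fun x => ‖u x‖ * M₁) (fun n => ?_)
      (hu.norm.mul_const _) (fun n => ae_of_all _ fun x => ?_) (ae_of_all _ fun x => ?_)
    · exact hu.aestronglyMeasurable.mul
        (((hsm n).continuous_fderiv (by simp)).clm_apply continuous_const).aestronglyMeasurable
    · rw [norm_mul, hfd]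
      exact mul_le_mul_of_nonneg_left (hbd _ _ hM₁ n x) (norm_nonneg _)
    · simp only [hfd]
      exact (hpt _ hdc x).const_mul _
  have hr : Tendsto (fun n => -∫ x in Ω, g x * mollify (k n) φ x) atTop
      (𝓝 (-∫ x in Ω, g x * φ x)) := by
    refine (tendsto_integral_of_dominated_convergence (fun x => ‖g x‖ * M₀) (fun n => ?_)
      (hg.norm.mul_const _) (fun n => ae_of_all _ fun x => ?_) (ae_of_all _ fun x => ?_)).neg
    · exact hg.aestronglyMeasurable.mul (hsm n).continuous.aestronglyMeasurable
    · rw [norm_mul]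
      exact mul_le_mul_of_nonneg_left (hbd _ _ hM₀ n x) (norm_nonneg _)
    · exact (hpt _ hφ.continuous x).const_mul _
  refine tendsto_nhds_unique (hl.congr' ?_) hr
  filter_upwards [hsupp] with n hn
  exact h _ (hsm n) (hcs n) hn

/-- The product rule for a weak derivative and a function of class `C¹`. -/
theorem HasWeakPartial.mul (hΩo : IsOpen Ω) (hΩb : Bornology.IsBounded Ω) (hu : IntegrableOn u Ω)
    (hg : IntegrableOn g Ω) (h : HasWeakPartial Ω i u g) {θ : Euc d → ℝ} (hθ : ContDiff ℝ 1 θ) :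
    HasWeakPartial Ω i (fun x => u x * θ x)
      (fun x => g x * θ x + u x * fderiv ℝ θ x (EuclideanSpace.single i 1)) := by
  intro φ hφ hc hs
  set ei : Euc d := EuclideanSpace.single i 1
  have hφ1 : ContDiff ℝ 1 φ := hφ.of_le (by exact_mod_cast le_top)
  have hdc : ∀ f : Euc d → ℝ, ContDiff ℝ 1 f → Continuous fun y => fderiv ℝ f y ei := fun f hf =>
    (hf.continuous_fderiv one_ne_zero).clm_apply continuous_const
  have key : ∫ x in Ω, u x * fderiv ℝ (fun x => θ x * φ x) x ei = -∫ x in Ω, g x * (θ x * φ x) :=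
    h.integral_contDiff_one hΩo hu hg (φ := fun x => θ x * φ x) (hθ.mul hφ1) hc.mul_left
      ((tsupport_mul_subset_right (f := θ) (g := φ)).trans hs)
  have hint : ∀ f : Euc d → ℝ, IntegrableOn f Ω → ∀ m : Euc d → ℝ, Continuous m →
      IntegrableOn (fun x => f x * m x) Ω := fun f hf m hm => by
    obtain ⟨M, hM⟩ := exists_bound_ae_restrict hΩo hΩb hm
    exact Integrable.mul_bdd hf hm.aestronglyMeasurable hM
  have h1 : ∀ x, u x * fderiv ℝ (fun x => θ x * φ x) x ei =
      u x * (θ x * fderiv ℝ φ x ei) + u x * (fderiv ℝ θ x ei * φ x) := fun x => by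
    rw [fderiv_fun_mul (hθ.differentiable one_ne_zero x) (hφ1.differentiable one_ne_zero x)]
    simp only [add_apply, smul_apply, smul_eq_mul]
    ring
  have hi1 : IntegrableOn (fun x => u x * (θ x * fderiv ℝ φ x ei)) Ω :=
    hint u hu _ (hθ.continuous.mul (hdc φ hφ1))
  have hi2 : IntegrableOn (fun x => u x * (fderiv ℝ θ x ei * φ x)) Ω :=
    hint u hu _ ((hdc θ hθ).mul hφ.continuous)
  have hi3 : IntegrableOn (fun x => g x * (θ x * φ x)) Ω :=
    hint g hg _ (hθ.continuous.mul hφ.continuous)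
  simp only [h1] at key
  rw [integral_add hi1 hi2] at key
  have h2 : ∫ x in Ω, (g x * θ x + u x * fderiv ℝ θ x ei) * φ x =
      (∫ x in Ω, g x * (θ x * φ x)) + ∫ x in Ω, u x * (fderiv ℝ θ x ei * φ x) := by
    rw [← integral_add hi3 hi2]
    refine integral_congr_ae (ae_of_all _ fun x => ?_)
    simp only
    ring
  have h3 : ∫ x in Ω, u x * θ x * fderiv ℝ φ x ei = ∫ x in Ω, u x * (θ x * fderiv ℝ φ x ei) :=
    integral_congr_ae (ae_of_all _ fun x => mul_assoc _ _ _)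
  linarith

theorem HasWeakPartial.ae_eq (hΩo : IsOpen Ω) {g' : Euc d → ℝ} (hg : IntegrableOn g Ω)
    (hg' : IntegrableOn g' Ω) (h : HasWeakPartial Ω i u g) (h' : HasWeakPartial Ω i u g') :
    g =ᵐ[volume.restrict Ω] g' := by
  rw [EventuallyEq, ae_restrict_iff' hΩo.measurableSet]
  have hd : IntegrableOn (fun x => g x - g' x) Ω := hg.sub hg'
  have hz := hΩo.ae_eq_zero_of_integral_contDiff_smul_eq_zero (μ := volume)
    (f := fun x => g x - g' x) hd.locallyIntegrableOn (fun φ hφ hc hs => ?_)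
  · filter_upwards [hz] with x hx hxΩ
    exact sub_eq_zero.1 (hx hxΩ)
  · have h1 := (h φ hφ hc hs).symm.trans (h' φ hφ hc hs)
    obtain ⟨M, hM⟩ := hc.exists_bound_of_continuous hφ.continuous
    have hint : ∀ f : Euc d → ℝ, IntegrableOn f Ω → IntegrableOn (fun x => f x * φ x) Ω :=
      fun f hf => Integrable.mul_bdd hf hφ.continuous.aestronglyMeasurable (ae_of_all _ hM)
    rw [← setIntegral_eq_integral_of_forall_compl_eq_zero (s := Ω)]
    · have h2 : ∀ x, φ x • (g x - g' x) = g x * φ x - g' x * φ x := fun x => by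
        rw [smul_eq_mul]; ring
      simp only [h2]
      rw [integral_sub (hint g hg) (hint g' hg')]
      linarith
    · intro x hx
      rw [image_eq_zero_of_notMem_tsupport fun hh => hx (hs hh), zero_smul]

end WeakProduct

/-! ### Integral curves of bounded Lipschitz fields -/

section Flow

variable {E : Type*} [NormedAddCommGroup E] [NormedSpace ℝ E] {θ : E → E} {K : ℝ≥0} {T : ℝ}
  {α β : ℝ → E}

/-- `α` solves the autonomous equation `α' = θ(α)` on `[0, T]`. -/
def IsIntegralCurveOnIcc (θ : E → E) (T : ℝ) (α : ℝ → E) : Prop :=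
  ∀ s ∈ Icc 0 T, HasDerivWithinAt α (θ (α s)) (Icc 0 T) s

theorem isIntegralCurveOnIcc_const {x : E} (hx : θ x = 0) :
    IsIntegralCurveOnIcc θ T fun _ => x := fun s _ => by
  rw [hx]
  exact hasDerivWithinAt_const _ _ _

theorem IsIntegralCurveOnIcc.mono {T' : ℝ} (hα : IsIntegralCurveOnIcc θ T α) (h : T' ≤ T) :
    IsIntegralCurveOnIcc θ T' α := fun s hs =>
  (hα s ⟨hs.1, hs.2.trans h⟩).mono (Icc_subset_Icc_right h)

theorem IsIntegralCurveOnIcc.eqOn_of_eq_left (hθ : LipschitzWith K θ)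
    (hα : IsIntegralCurveOnIcc θ T α) (hβ : IsIntegralCurveOnIcc θ T β) (h : α 0 = β 0) :
    EqOn α β (Icc 0 T) :=
  ODE_solution_unique (v := fun _ => θ) (fun _ => hθ)
    (fun s hs => (hα s hs).continuousWithinAt)
    (fun s hs => (hα s (Ico_subset_Icc_self hs)).mono_of_mem_nhdsWithin
      (Icc_mem_nhdsGE_of_mem hs))
    (fun s hs => (hβ s hs).continuousWithinAt)
    (fun s hs => (hβ s (Ico_subset_Icc_self hs)).mono_of_mem_nhdsWithin
      (Icc_mem_nhdsGE_of_mem hs)) h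

theorem IsIntegralCurveOnIcc.eqOn_of_eq_right (hθ : LipschitzWith K θ)
    (hα : IsIntegralCurveOnIcc θ T α) (hβ : IsIntegralCurveOnIcc θ T β) (h : α T = β T) :
    EqOn α β (Icc 0 T) :=
  ODE_solution_unique_of_mem_Icc_left (v := fun _ => θ) (s := fun _ => univ)
    (fun _ _ => hθ.lipschitzOnWith)
    (fun s hs => (hα s hs).continuousWithinAt)
    (fun s hs => (hα s (Ioc_subset_Icc_self hs)).mono_of_mem_nhdsWithin
      (Icc_mem_nhdsLE_of_mem hs)) (fun _ _ => mem_univ _)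
    (fun s hs => (hβ s hs).continuousWithinAt)
    (fun s hs => (hβ s (Ioc_subset_Icc_self hs)).mono_of_mem_nhdsWithin
      (Icc_mem_nhdsLE_of_mem hs)) (fun _ _ => mem_univ _) h

/-- A bounded Lipschitz field can be integrated backwards over any time. -/
theorem exists_isIntegralCurveOnIcc_eq [CompleteSpace E] (hθ : LipschitzWith K θ) {M : ℝ≥0}
    (hM : ∀ x, ‖θ x‖ ≤ M) (hT : 0 ≤ T) (y : E) :
    ∃ α : ℝ → E, α T = y ∧ IsIntegralCurveOnIcc θ T α := by
  have hpl : IsPicardLindelof (fun _ => θ) (tmin := 0) (tmax := T) ⟨T, hT, le_rfl⟩ y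
      (M * T.toNNReal) 0 M K :=
    { lipschitzOnWith := fun _ _ => hθ.lipschitzOnWith
      continuousOn := fun _ _ => continuousOn_const
      norm_le := fun _ _ x _ => hM x
      mul_max_le := by simp [hT] }
  exact hpl.exists_eq_forall_mem_Icc_hasDerivWithinAt₀

/-- An integral curve of a field vanishing off `U` cannot leave or enter `U`: where the field
vanishes, the only integral curve is constant. -/
theorem IsIntegralCurveOnIcc.mem_iff_mem (hθ : LipschitzWith K θ) {U : Set E}
    (hU : ∀ x ∉ U, θ x = 0) (hα : IsIntegralCurveOnIcc θ T α) (hT : 0 ≤ T) :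
    α 0 ∈ U ↔ α T ∈ U := by
  constructor <;> intro h <;> by_contra hn
  · exact hn ((hα.eqOn_of_eq_right hθ (isIntegralCurveOnIcc_const (hU _ hn)) rfl
      ⟨le_rfl, hT⟩) ▸ h)
  · exact hn ((hα.eqOn_of_eq_left hθ (isIntegralCurveOnIcc_const (hU _ hn)) rfl
      ⟨hT, le_rfl⟩) ▸ h)

end Flow

/-! ### Variations supported in one phase -/

section Variations

variable {d κ : ℕ} {D : Set (Euc d)} {θ : Euc d → Euc d} {t₀ : ℝ} {Φ : ℝ → Euc d → Euc d}

theorem IsFlowOn.isIntegralCurveOnIcc (hΦ : IsFlowOn D θ t₀ Φ) {x : Euc d} (hx : x ∈ closure D) :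
    IsIntegralCurveOnIcc θ t₀ fun s => Φ s x := fun s hs => ((hΦ x hx).2 s hs).2

/-- The flow of a field supported in `U ⊆ D` maps every subset of `D` that contains `U` or is
disjoint from `U` onto itself. -/
theorem IsFlowOn.image_eq (hΦ : IsFlowOn D θ t₀ Φ) (hθ : ContDiff ℝ 1 θ)
    (hc : HasCompactSupport θ) {U V : Set (Euc d)} (hUD : U ⊆ D) (hVD : V ⊆ D)
    (hU : ∀ x ∉ U, θ x = 0) (hUV : U = V ∨ Disjoint U V) {t : ℝ} (ht : t ∈ Icc 0 t₀) :
    Φ t '' V = V := by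
  obtain ⟨K, hK⟩ := hθ.lipschitzWith_of_hasCompactSupport hc one_ne_zero
  have hcurve : ∀ x ∈ D, IsIntegralCurveOnIcc θ t fun s => Φ s x := fun x hx =>
    (hΦ.isIntegralCurveOnIcc (subset_closure hx)).mono ht.2
  rcases hUV with rfl | hdis
  · refine Subset.antisymm ?_ fun y hy => ?_
    · rintro _ ⟨x, hx, rfl⟩
      refine ((hcurve x (hUD hx)).mem_iff_mem hK hU ht.1).1 ?_
      simpa only [(hΦ x (subset_closure (hUD hx))).1] using hx
    · obtain ⟨M, hM⟩ := hc.exists_bound_of_continuous hθ.continuous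
      obtain ⟨α, rfl, hα⟩ := exists_isIntegralCurveOnIcc_eq hK (M := M.toNNReal)
        (fun x => (hM x).trans (Real.le_coe_toNNReal M)) ht.1 y
      have h0 : α 0 ∈ U := (hα.mem_iff_mem hK hU ht.1).2 hy
      exact ⟨α 0, h0, (hcurve _ (hUD h0)).eqOn_of_eq_left hK hα
        (hΦ _ (subset_closure (hUD h0))).1 ⟨ht.1, le_rfl⟩⟩
  · have hfix : ∀ x ∈ V, Φ t x = x := fun x hx =>
      (hcurve x (hVD hx)).eqOn_of_eq_left hK
        (isIntegralCurveOnIcc_const (hU x fun hxU => disjoint_left.1 hdis hxU hx))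
        (hΦ _ (subset_closure (hVD hx))).1 ⟨ht.1, le_rfl⟩
    rw [image_congr hfix, image_id']

/-- A variation supported inside one phase does not change the partition, so the shape derivative
in its direction vanishes. -/
theorem HasEulerianDeriv.eq_zero_of_support_subset {J : KPartition D κ → ℝ} {Ω : KPartition D κ}
    {L : ℝ} (h : HasEulerianDeriv J Ω θ L) (hθ : ContDiff ℝ 1 θ) (hc : HasCompactSupport θ)
    {k : Fin κ} (hk : ∀ x ∉ Ω.phase k, θ x = 0) : L = 0 := by
  obtain ⟨t₀, ht₀, Φ, hΦ, Ωt, hΩt, hlim⟩ := h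
  have hconst : ∀ t ∈ Icc 0 t₀, Ωt t = Ω := fun t ht => by
    refine KPartition.ext (funext fun l => ?_)
    rw [hΩt t ht l]
    refine hΦ.image_eq hθ hc (Ω.phase_subset k) (Ω.phase_subset l) hk ?_ ht
    by_cases hkl : k = l
    · exact Or.inl (by rw [hkl])
    · exact Or.inr (Ω.disjoint_phase k l hkl)
  refine tendsto_nhds_unique hlim (tendsto_const_nhds.congr' ?_)
  filter_upwards [Ioc_mem_nhdsGT ht₀] with t ht
  rw [hconst t ⟨ht.1.le, ht.2⟩, sub_self, zero_div]

theorem isAdmissibleField_of_support_subset (hDo : IsOpen D) (hθ : ContDiff ℝ 1 θ)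
    (h : ∀ x ∉ D, θ x = 0) : IsAdmissibleField D θ := by
  have h0 : ∀ x ∈ frontier D, θ x = 0 := fun x hx => h x fun hxD =>
    disjoint_left.1 (disjoint_frontier_iff_isOpen.2 hDo) hx hxD
  refine ⟨hθ, fun x hx => ?_, fun x hx _ => h0 x hx⟩
  rw [h0 x hx.1, inner_zero_left]

end Variations

/-! ### The tensor representation of the shape derivative -/

section Representation

variable {d κ : ℕ} {D : Set (Euc d)} {U : Set (Euc d)} {S₀ : Euc d → Euc d}
  {S₁ : Euc d → Matrix (Fin d) (Fin d) ℝ} {θ : Euc d → Euc d}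

/-- The integrand `S₁ : Dθ + S₀ · θ` of the tensor representation. -/
noncomputable def tensorIntegrand (S₀ : Euc d → Euc d) (S₁ : Euc d → Matrix (Fin d) (Fin d) ℝ)
    (θ : Euc d → Euc d) (x : Euc d) : ℝ :=
  (∑ i, ∑ j, S₁ x i j * (fderiv ℝ θ x (EuclideanSpace.single j 1)) i) + inner ℝ (S₀ x) (θ x)

theorem contDiff_apply_coord (hθ : ContDiff ℝ 1 θ) (i : Fin d) : ContDiff ℝ 1 fun x => θ x i :=
  (EuclideanSpace.proj (𝕜 := ℝ) i).contDiff.comp hθ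

theorem fderiv_apply_coord (hθ : ContDiff ℝ 1 θ) (x v : Euc d) (i : Fin d) :
    (fderiv ℝ θ x v) i = fderiv ℝ (fun y => θ y i) x v := by
  have h := (EuclideanSpace.proj (𝕜 := ℝ) i : Euc d →L[ℝ] ℝ).hasFDerivAt.comp x
    (hθ.differentiable one_ne_zero x).hasFDerivAt
  have h' : HasFDerivAt (fun y => θ y i)
      ((EuclideanSpace.proj (𝕜 := ℝ) i : Euc d →L[ℝ] ℝ).comp (fderiv ℝ θ x)) x := h
  rw [h'.fderiv]
  rfl

theorem integrableOn_mul_of_continuous (hUo : IsOpen U) (hUb : Bornology.IsBounded U)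
    {f m : Euc d → ℝ} (hf : IntegrableOn f U) (hm : Continuous m) :
    IntegrableOn (fun x => f x * m x) U := by
  obtain ⟨M, hM⟩ := exists_bound_ae_restrict hUo hUb hm
  exact Integrable.mul_bdd hf hm.aestronglyMeasurable hM

theorem integrableOn_tensorIntegrand (hDo : IsOpen D) (hDb : Bornology.IsBounded D)
    (h₀ : IntegrableOn S₀ D) (h₁ : ∀ i j, IntegrableOn (fun x => S₁ x i j) D)
    (hθ : ContDiff ℝ 1 θ) : IntegrableOn (tensorIntegrand S₀ S₁ θ) D := by
  refine Integrable.add (integrable_finsetSum _ fun i _ => integrable_finsetSum _ fun j _ => ?_) ?_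
  · simp only [fderiv_apply_coord hθ]
    exact integrableOn_mul_of_continuous hDo hDb (h₁ i j)
      (((contDiff_apply_coord hθ i).continuous_fderiv one_ne_zero).clm_apply continuous_const)
  · simp only [PiLp.inner_apply]
    refine integrable_finsetSum _ fun i _ => ?_
    simp only [RCLike.inner_apply, conj_trivial]
    have h : IntegrableOn (fun x => S₀ x i) D :=
      (EuclideanSpace.proj (𝕜 := ℝ) i : Euc d →L[ℝ] ℝ).integrable_comp h₀
    exact (integrableOn_mul_of_continuous hDo hDb h (contDiff_apply_coord hθ i).continuous).congr
      (ae_of_all _ fun x => mul_comm _ _)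

/-- If the phases fill `D` up to a null set, integrals over `D` split into integrals over the
phases. -/
theorem KPartition.setIntegral_eq_sum (Ω : KPartition D κ)
    (hnull : volume (D \ ⋃ k, Ω.phase k) = 0) {f : Euc d → ℝ} (hf : IntegrableOn f D) :
    ∫ x in D, f x = ∑ k, ∫ x in Ω.phase k, f x := by
  have hsub : (⋃ k, Ω.phase k) ⊆ D := iUnion_subset Ω.phase_subset
  have hae : D =ᵐ[volume] ⋃ k, Ω.phase k :=
    (ae_le_set.2 hnull).antisymm hsub.eventuallyLE
  rw [setIntegral_congr_set hae, integral_iUnion_fintype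
    (fun k => (Ω.isOpen_phase k).measurableSet) (fun k l hkl => Ω.disjoint_phase k l hkl)
    (fun k => hf.mono_set (Ω.phase_subset k))]

/-- Lipschitz phases leave out only a null set, since their boundaries are null. -/
theorem KPartition.volume_diff_eq_zero (hd : 0 < d) (hDb : Bornology.IsBounded D)
    (Ω : KPartition D κ) (hΩ : ∀ k, IsLipschitzSet (Ω.phase k)) :
    volume (D \ ⋃ k, Ω.phase k) = 0 := by
  refine measure_mono_null (t := ⋃ k, frontier (Ω.phase k)) (fun x hx => ?_)
    (measure_iUnion_null fun k => (hΩ k).volume_frontier hd (Ω.isOpen_phase k)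
      (hDb.subset (Ω.phase_subset k)))
  have h : x ∈ ⋃ k, closure (Ω.phase k) := Ω.iUnion_closure ▸ subset_closure hx.1
  obtain ⟨k, hk⟩ := mem_iUnion.1 h
  refine mem_iUnion.2 ⟨k, ?_⟩
  rw [(Ω.isOpen_phase k).frontier_eq]
  exact ⟨hk, fun hxk => hx.2 (mem_iUnion.2 ⟨k, hxk⟩)⟩

/-- Testing the representation with a smooth variation of the `i`-th coordinate supported inside a
phase. -/
theorem HasTensorRepresentation.setIntegral_phase_eq_zero {J : KPartition D κ → ℝ}
    {Ω : KPartition D κ} (hDo : IsOpen D) (hJ : HasTensorRepresentation J Ω S₀ S₁) (k : Fin κ)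
    (i : Fin d) {φ : Euc d → ℝ} (hφ : ContDiff ℝ ∞ φ) (hc : HasCompactSupport φ)
    (hs : tsupport φ ⊆ Ω.phase k) :
    ∫ x in Ω.phase k, ((∑ j, S₁ x i j * fderiv ℝ φ x (EuclideanSpace.single j 1)) +
      S₀ x i * φ x) = 0 := by
  have hφ1 : ContDiff ℝ 1 φ := hφ.of_le (by exact_mod_cast le_top)
  set θ : Euc d → Euc d := fun x => φ x • EuclideanSpace.single i (1 : ℝ) with hθdef
  have hθ : ContDiff ℝ 1 θ := hφ1.smul contDiff_const
  have hz : ∀ x ∉ Ω.phase k, φ x = 0 := fun x hx =>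
    image_eq_zero_of_notMem_tsupport fun h => hx (hs h)
  have hθz : ∀ x ∉ Ω.phase k, θ x = 0 := fun x hx => by simp only [hθdef, hz x hx, zero_smul]
  have hθc : HasCompactSupport θ := hc.smul_right
  have hadm : IsAdmissibleField D θ := isAdmissibleField_of_support_subset hDo hθ fun x hx =>
    hθz x fun h => hx (Ω.phase_subset k h)
  have h0 := (hJ.2.2 θ hadm).eq_zero_of_support_subset hθ hθc hθz
  have heq : ∀ x, (∑ i, ∑ j, S₁ x i j * (fderiv ℝ θ x (EuclideanSpace.single j 1)) i) +
      inner ℝ (S₀ x) (θ x) =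
      (∑ j, S₁ x i j * fderiv ℝ φ x (EuclideanSpace.single j 1)) + S₀ x i * φ x := by
    intro x
    have hfd : fderiv ℝ θ x =
        (fderiv ℝ φ x).smulRight (EuclideanSpace.single i (1 : ℝ)) :=
      fderiv_smul_const (hφ1.differentiable one_ne_zero x) _
    congr 1
    · -- only the `i`-th coordinate of `θ` is nonzero
      rw [Finset.sum_eq_single i]
      · simp [hfd]
      · intro l _ hl
        simp [hfd, hl]
      · simp
    · simp [hθdef, inner_smul_right, EuclideanSpace.inner_single_right, mul_comm]
  simp only [heq] at h0
  rw [← h0]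
  refine (setIntegral_eq_of_subset_of_forall_sdiff_eq_zero hDo.measurableSet (Ω.phase_subset k)
    fun x hx => ?_).symm
  have hxs : x ∉ tsupport φ := fun h => hx.2 (hs h)
  have hfd : fderiv ℝ φ x = 0 :=
    image_eq_zero_of_notMem_tsupport fun h => hxs (tsupport_fderiv_subset ℝ h)
  simp [hfd, hz x hx.2]

/-- A function `s` such that `∫ (∑ⱼ aⱼ ∂ⱼφ + s φ) = 0` for all test functions is the weak divergence
of `a`. -/
theorem weakDiv_ae_eq (hUo : IsOpen U) {a : Fin d → Euc d → ℝ} {s : Euc d → ℝ}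
    (ha : ∀ j, MemW11 U (a j)) (hs : IntegrableOn s U)
    (h : ∀ φ : Euc d → ℝ, ContDiff ℝ ∞ φ → HasCompactSupport φ → tsupport φ ⊆ U →
      ∫ x in U, ((∑ j, a j x * fderiv ℝ φ x (EuclideanSpace.single j 1)) + s x * φ x) = 0) :
    weakDiv U a =ᵐ[volume.restrict U] s := by
  have hp := fun j => (ha j).weakPartial_spec j
  have hdi : IntegrableOn (weakDiv U a) U := integrable_finsetSum _ fun j _ => (hp j).1
  rw [EventuallyEq, ae_restrict_iff' hUo.measurableSet]
  have hd : IntegrableOn (fun x => weakDiv U a x - s x) U := hdi.sub hs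
  have hz := hUo.ae_eq_zero_of_integral_contDiff_smul_eq_zero (μ := volume)
    (f := fun x => weakDiv U a x - s x) hd.locallyIntegrableOn (fun φ hφ hc hsφ => ?_)
  · filter_upwards [hz] with x hx hxU
    exact sub_eq_zero.1 (hx hxU)
  · have hdc : ∀ j : Fin d, Continuous fun x => fderiv ℝ φ x (EuclideanSpace.single j 1) :=
      fun j => (hφ.continuous_fderiv (by simp)).clm_apply continuous_const
    have hmul : ∀ f m : Euc d → ℝ, IntegrableOn f U → Continuous m → HasCompactSupport m →
        IntegrableOn (fun x => f x * m x) U := fun f m hf hm hmc => by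
      obtain ⟨M, hM⟩ := hmc.exists_bound_of_continuous hm
      exact Integrable.mul_bdd hf hm.aestronglyMeasurable (ae_of_all _ hM)
    have hi1 : ∀ j, IntegrableOn (fun x => a j x * fderiv ℝ φ x (EuclideanSpace.single j 1)) U :=
      fun j => hmul _ _ (ha j).1 (hdc j) (hc.fderiv_apply (𝕜 := ℝ) _)
    have hi2 : IntegrableOn (fun x => s x * φ x) U := hmul _ _ hs hφ.continuous hc
    have hi3 : ∀ j, IntegrableOn (fun x => weakPartial U j (a j) x * φ x) U :=
      fun j => hmul _ _ (hp j).1 hφ.continuous hc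
    have h1 := h φ hφ hc hsφ
    rw [integral_add (integrable_finsetSum _ fun j _ => hi1 j) hi2,
      integral_finsetSum _ fun j _ => hi1 j,
      Finset.sum_congr rfl fun j _ => (hp j).2 φ hφ hc hsφ] at h1
    rw [← setIntegral_eq_integral_of_forall_compl_eq_zero (s := U)]
    · have h2 : ∀ x, φ x • (weakDiv U a x - s x) =
          (∑ j, weakPartial U j (a j) x * φ x) - s x * φ x := fun x => by
        rw [smul_eq_mul, ← Finset.sum_mul, weakDiv]; ring
      simp only [h2]
      rw [integral_sub (integrable_finsetSum _ fun j _ => hi3 j) hi2,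
        integral_finsetSum _ fun j _ => hi3 j]
      rw [Finset.sum_neg_distrib] at h1
      linarith
    · intro x hx
      rw [image_eq_zero_of_notMem_tsupport fun hh => hx (hsφ hh), zero_smul]

/-- Where `S₀ = div S₁`, the tensor integrand is a sum of integrands of integrations by parts. -/
theorem tensorIntegrand_ae_eq (hθ : ContDiff ℝ 1 θ)
    (hdiv : ∀ᵐ x ∂(volume.restrict U), ∀ i, weakDiv U (fun j y => S₁ y i j) x = S₀ x i) :
    tensorIntegrand S₀ S₁ θ =ᵐ[volume.restrict U] fun x => ∑ j, ∑ i,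
      (weakPartial U j (fun y => S₁ y i j) x * θ x i +
        S₁ x i j * fderiv ℝ (fun y => θ y i) x (EuclideanSpace.single j 1)) := by
  filter_upwards [hdiv] with x hx
  rw [tensorIntegrand, Finset.sum_comm (γ := Fin d)]
  simp only [fderiv_apply_coord hθ, PiLp.inner_apply, ← hx, RCLike.inner_apply, conj_trivial,
    weakDiv, Finset.mul_sum, Finset.sum_add_distrib]
  rw [add_comm, Finset.sum_comm]
  congr 1
  exact Finset.sum_congr rfl fun _ _ => Finset.sum_congr rfl fun _ _ => mul_comm _ _

theorem HasWeakPartial.sum {ι : Type*} (s : Finset ι) {j : Fin d} {u g : ι → Euc d → ℝ}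
    (hu : ∀ i ∈ s, IntegrableOn (u i) U) (hg : ∀ i ∈ s, IntegrableOn (g i) U)
    (h : ∀ i ∈ s, HasWeakPartial U j (u i) (g i)) :
    HasWeakPartial U j (fun x => ∑ i ∈ s, u i x) (fun x => ∑ i ∈ s, g i x) := by
  intro φ hφ hc hs
  have hdc : Continuous fun x => fderiv ℝ φ x (EuclideanSpace.single j 1) :=
    (hφ.continuous_fderiv (by simp)).clm_apply continuous_const
  have hmul : ∀ f m : Euc d → ℝ, IntegrableOn f U → Continuous m → HasCompactSupport m →
      IntegrableOn (fun x => f x * m x) U := fun f m hf hm hmc => by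
    obtain ⟨M, hM⟩ := hmc.exists_bound_of_continuous hm
    exact Integrable.mul_bdd hf hm.aestronglyMeasurable (ae_of_all _ hM)
  simp only [Finset.sum_mul]
  rw [integral_finsetSum _ fun i hi => hmul _ _ (hu i hi) hdc (hc.fderiv_apply (𝕜 := ℝ) _),
    integral_finsetSum _ fun i hi => hmul _ _ (hg i hi) hφ.continuous hc,
    ← Finset.sum_neg_distrib]
  exact Finset.sum_congr rfl fun i hi => h i hi φ hφ hc hs

/-- The product rule for the components of `S₁ᵀ θ`. -/
theorem hasWeakPartial_transpose_mul (hUo : IsOpen U) (hUb : Bornology.IsBounded U)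
    (hS : ∀ i j, MemW11 U fun x => S₁ x i j) (hθ : ContDiff ℝ 1 θ) (l j : Fin d) :
    IntegrableOn (fun x => ∑ i, (weakPartial U l (fun y => S₁ y i j) x * θ x i +
        S₁ x i j * fderiv ℝ (fun y => θ y i) x (EuclideanSpace.single l 1))) U ∧
    HasWeakPartial U l (fun x => ∑ i, S₁ x i j * θ x i) (fun x => ∑ i,
      (weakPartial U l (fun y => S₁ y i j) x * θ x i +
        S₁ x i j * fderiv ℝ (fun y => θ y i) x (EuclideanSpace.single l 1))) := by
  have hθi := contDiff_apply_coord hθ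
  have hp := fun i => (hS i j).weakPartial_spec l
  have hi : ∀ i, IntegrableOn (fun x => weakPartial U l (fun y => S₁ y i j) x * θ x i +
      S₁ x i j * fderiv ℝ (fun y => θ y i) x (EuclideanSpace.single l 1)) U := fun i =>
    (integrableOn_mul_of_continuous hUo hUb (hp i).1 (hθi i).continuous).add
      (integrableOn_mul_of_continuous hUo hUb (hS i j).1
        (((hθi i).continuous_fderiv one_ne_zero).clm_apply continuous_const))
  exact ⟨integrable_finsetSum _ fun i _ => hi i, HasWeakPartial.sum _
    (fun i _ => integrableOn_mul_of_continuous hUo hUb (hS i j).1 (hθi i).continuous)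
    (fun i _ => hi i) fun i _ => (hp i).2.mul hUo hUb (hS i j).1 (hp i).1 (hθi i)⟩

theorem memW11_transpose_mul (hUo : IsOpen U) (hUb : Bornology.IsBounded U)
    (hS : ∀ i j, MemW11 U fun x => S₁ x i j) (hθ : ContDiff ℝ 1 θ) (j : Fin d) :
    MemW11 U fun x => ∑ i, S₁ x i j * θ x i :=
  ⟨integrable_finsetSum _ fun i _ => integrableOn_mul_of_continuous hUo hUb (hS i j).1
    (contDiff_apply_coord hθ i).continuous, fun l =>
    ⟨_, hasWeakPartial_transpose_mul hUo hUb hS hθ l j⟩⟩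

/-- `∫ S₁ : Dθ + S₀ · θ = ∫ div (S₁ᵀ θ)` where `S₀ = div S₁`. -/
theorem setIntegral_tensorIntegrand_eq_weakDiv (hUo : IsOpen U) (hUb : Bornology.IsBounded U)
    (hS : ∀ i j, MemW11 U fun x => S₁ x i j) (hθ : ContDiff ℝ 1 θ)
    (hdiv : ∀ᵐ x ∂(volume.restrict U), ∀ i, weakDiv U (fun j y => S₁ y i j) x = S₀ x i) :
    ∫ x in U, tensorIntegrand S₀ S₁ θ x =
      ∫ x in U, weakDiv U (fun j y => ∑ i, S₁ y i j * θ y i) x := by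
  refine integral_congr_ae ((tensorIntegrand_ae_eq hθ hdiv).trans ?_)
  have h : ∀ j, _ := fun j =>
    have hw := (memW11_transpose_mul hUo hUb hS hθ j).weakPartial_spec j
    have hp := hasWeakPartial_transpose_mul hUo hUb hS hθ j j
    hp.2.ae_eq hUo hp.1 hw.1 hw.2
  filter_upwards [ae_all_iff.2 h] with x hx
  exact Finset.sum_congr rfl fun j _ => hx j

theorem integrable_trace_mul {T : Euc d → Matrix (Fin d) (Fin d) ℝ} (hUo : IsOpen U)
    (hUb : Bornology.IsBounded U) (hU : IsLipschitzSet U)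
    (hT : ∀ i j, IsTrace U (fun x => S₁ x i j) fun x => T x i j) (hθ : ContDiff ℝ 1 θ) :
    Integrable (fun x => ∑ i, (∑ j, T x i j * outwardNormal U x j) * θ x i)
      (surfaceMeasure U) := by
  simp only [Finset.sum_mul]
  exact integrable_finsetSum _ fun i _ => integrable_finsetSum _ fun j _ =>
    (hT i j).integrable_mul hUo hUb hU (contDiff_apply_coord hθ i).continuous j

/-- `∫ S₁ : Dθ + S₀ · θ = ∫ (S₁ n) · θ` on the boundary, where `S₀ = div S₁`. -/
theorem setIntegral_tensorIntegrand_eq_trace {T : Euc d → Matrix (Fin d) (Fin d) ℝ}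
    (hUo : IsOpen U) (hUb : Bornology.IsBounded U) (hU : IsLipschitzSet U)
    (hT : ∀ i j, IsTrace U (fun x => S₁ x i j) fun x => T x i j) (hθ : ContDiff ℝ 1 θ)
    (hdiv : ∀ᵐ x ∂(volume.restrict U), ∀ i, weakDiv U (fun j y => S₁ y i j) x = S₀ x i) :
    ∫ x in U, tensorIntegrand S₀ S₁ θ x =
      ∫ x, (∑ i, (∑ j, T x i j * outwardNormal U x j) * θ x i) ∂(surfaceMeasure U) := by
  have hθi := contDiff_apply_coord hθ
  have hi : ∀ i j, IntegrableOn (fun x => weakPartial U j (fun y => S₁ y i j) x * θ x i +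
      S₁ x i j * fderiv ℝ (fun y => θ y i) x (EuclideanSpace.single j 1)) U := fun i j =>
    (integrableOn_mul_of_continuous hUo hUb ((hT i j).1.weakPartial_spec j).1
      (hθi i).continuous).add
      (integrableOn_mul_of_continuous hUo hUb (hT i j).1.1
        (((hθi i).continuous_fderiv one_ne_zero).clm_apply continuous_const))
  have hb : ∀ i j, Integrable (fun x => T x i j * outwardNormal U x j * θ x i)
      (surfaceMeasure U) := fun i j => (hT i j).integrable_mul hUo hUb hU (hθi i).continuous j
  rw [integral_congr_ae (tensorIntegrand_ae_eq hθ hdiv),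
    integral_finsetSum _ fun j _ => integrable_finsetSum _ fun i _ => hi i j, Finset.sum_congr rfl
      fun j _ => integral_finsetSum _ fun i _ => hi i j, Finset.sum_comm]
  simp only [Finset.sum_mul]
  rw [integral_finsetSum _ fun i _ => integrable_finsetSum _ fun j _ => hb i j]
  refine Finset.sum_congr rfl fun i _ => ?_
  rw [integral_finsetSum _ fun j _ => hb i j]
  exact Finset.sum_congr rfl fun j _ => (hT i j).setIntegral_eq hUo hUb hU (hθi i) j

end Representation

end MultiphaseShape

theorem mainTheorem5 (d κ : ℕ) (hd : 2 ≤ d)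
    (D : Set (EuclideanSpace ℝ (Fin d))) (hDo : IsOpen D) (hDb : Bornology.IsBounded D)
    (J : KPartition D κ → ℝ) (Ω : KPartition D κ)
    (S₀ : EuclideanSpace ℝ (Fin d) → EuclideanSpace ℝ (Fin d))
    (S₁ : EuclideanSpace ℝ (Fin d) → Matrix (Fin d) (Fin d) ℝ)
    (hJ : HasTensorRepresentation J Ω S₀ S₁)
    (hS : ∀ k i j, MemW11 (Ω.phase k) (fun x => S₁ x i j)) :
    (∀ k, ∀ᵐ x ∂(volume.restrict (Ω.phase k)), ∀ i,
      weakDiv (Ω.phase k) (fun j y => S₁ y i j) x = S₀ x i) ∧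
    (volume (D \ ⋃ k, Ω.phase k) = 0 → ∀ θ, IsAdmissibleField D θ →
      (∀ k j, MemW11 (Ω.phase k) (fun x => ∑ i, S₁ x i j * θ x i)) ∧
      HasEulerianDeriv J Ω θ
        (∑ k, ∫ x in Ω.phase k, weakDiv (Ω.phase k) (fun j y => ∑ i, S₁ y i j * θ y i) x)) ∧
    ((∀ k, IsLipschitzSet (Ω.phase k)) →
      (∃ T : Fin κ → EuclideanSpace ℝ (Fin d) → Matrix (Fin d) (Fin d) ℝ,
        ∀ k i j, IsTrace (Ω.phase k) (fun x => S₁ x i j) (fun x => T k x i j)) ∧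
      ∀ T : Fin κ → EuclideanSpace ℝ (Fin d) → Matrix (Fin d) (Fin d) ℝ,
        (∀ k i j, IsTrace (Ω.phase k) (fun x => S₁ x i j) (fun x => T k x i j)) →
        ∀ θ, IsAdmissibleField D θ →
          (∀ k, Integrable
            (fun x => ∑ i, (∑ j, T k x i j * outwardNormal (Ω.phase k) x j) * θ x i)
            (surfaceMeasure (Ω.phase k))) ∧
          HasEulerianDeriv J Ω θ
            (∑ k, ∫ x, (∑ i, (∑ j, T k x i j * outwardNormal (Ω.phase k) x j) * θ x i)
              ∂(surfaceMeasure (Ω.phase k)))) := by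
  have hb : ∀ k, Bornology.IsBounded (Ω.phase k) := fun k => hDb.subset (Ω.phase_subset k)
  have ho := Ω.isOpen_phase
  have hdiv : ∀ k, ∀ᵐ x ∂(volume.restrict (Ω.phase k)), ∀ i,
      weakDiv (Ω.phase k) (fun j y => S₁ y i j) x = S₀ x i := fun k => by
    refine ae_all_iff.2 fun i => weakDiv_ae_eq (ho k) (fun j => hS k i j) ?_
      fun φ hφ hc hs => hJ.setIntegral_phase_eq_zero hDo k i hφ hc hs
    have h : IntegrableOn (fun x => S₀ x i) D :=
      (EuclideanSpace.proj (𝕜 := ℝ) i : Euc d →L[ℝ] ℝ).integrable_comp hJ.1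
    exact h.mono_set (Ω.phase_subset k)
  -- the value of the derivative is the integral over `D`, which may be computed phase by phase
  have hsum : volume (D \ ⋃ k, Ω.phase k) = 0 → ∀ θ, IsAdmissibleField D θ →
      ∀ I : Fin κ → ℝ, (∀ k, ∫ x in Ω.phase k, tensorIntegrand S₀ S₁ θ x = I k) →
      HasEulerianDeriv J Ω θ (∑ k, I k) := fun hnull θ hθ I hI => by
    have h := hJ.2.2 θ hθ
    have hsplit : ∫ x in D, tensorIntegrand S₀ S₁ θ x = ∑ k, I k := by
      rw [Ω.setIntegral_eq_sum hnull
        (integrableOn_tensorIntegrand hDo hDb hJ.1 hJ.2.1 hθ.1)]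
      exact Finset.sum_congr rfl fun k _ => hI k
    rw [← hsplit]
    exact h
  refine ⟨hdiv, fun hnull θ hθ => ⟨fun k j => memW11_transpose_mul (ho k) (hb k) (hS k) hθ.1 j,
    hsum hnull θ hθ _ fun k =>
      setIntegral_tensorIntegrand_eq_weakDiv (ho k) (hb k) (hS k) hθ.1 (hdiv k)⟩,
    fun hLip => ⟨?_, fun T hT θ hθ => ⟨fun k =>
      integrable_trace_mul (ho k) (hb k) (hLip k) (hT k) hθ.1,
      hsum (Ω.volume_diff_eq_zero (by lia) hDb hLip) θ hθ _ fun k =>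
        setIntegral_tensorIntegrand_eq_trace (ho k) (hb k) (hLip k) (hT k) hθ.1 (hdiv k)⟩⟩⟩
  choose T hT using fun k i j => (hLip k).exists_isTrace (ho k) (hb k) (hS k i j)
  exact ⟨fun k x => Matrix.of fun i j => T k i j x, hT⟩
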